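/- **Setting.** For integers $1\le s\le d$ let $\mathcal F_{d,s}$ be the distribution of the sparse linear map $\varphi:\mathbb R^d\times\mathbb R^d\to\mathbb R^d$, $\varphi(v,w)=A_0v+A_1w$, where $A_0,A_1$ are random $d\times d$ matrices all of whose $2d$ columns are independent; in each column a uniformly random set of exactly $s$ positions carries nonzero entries, and these are independent and uniform in $\{-1/\sqrt s,\,1/\sqrt s\}$. For an integer $u\ge 2$ let $k=\lceil\log_2\lceil u/d\rceil\rceil$ (so $k=\log_2(u/d)$ if $u/d$ is a power of two), and let $\varphi'_1,\dots,\varphi'_k$ be fully independent samples of $\mathcal F_{d,s}$. Put $s_0=(1,\dots,1)\in\mathbb R^d$ and $s_i=\varphi'_i(s_{i-1},s_{i-1})$. For an integer $x$ let $\mathrm{Project}(x,0)=(1,\dots,1,0,\dots,0)\in\mathbb R^d$ with $x$ ones, and for $c\ge1$ $$\mathrm{Project}(x,c)=\begin{cases}\varphi'_c\big(\mathrm{Project}(x,c-1),\,0\big) & \text{if } x<\tfrac12 d2^c,\\ \varphi'_c\big(s_{c-1},\,\mathrm{Project}(x-\tfrac12d2^c,\,c-1)\big)&\text{otherwise.}\end{cases}$$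 Let $\psi(x)=\mathrm{Project}(x,k)$ for integers $0\le x\le u$. Let $\pi_0=\mathrm{id}_{\mathbb R^d}$ and let $\pi_i:\mathbb R^{d2^i}\to\mathbb R^d$ be the linear map $\pi_i(z)=\varphi'_i(\pi_{i-1}(z_{\mathrm{left}}),\pi_{i-1}(z_{\mathrm{right}}))$, where $z_{\mathrm{left}},z_{\mathrm{right}}$ are the two halves of $z$. Write $A=(1\pm\eta)B$ for $(1-\eta)B\le A\le(1+\eta)B$. **Lemma.** There are an absolute constant $C_1$ and a fixed program for the real-number random access machine (integer and real registers and indirectly addressed memories; unit-cost addition, subtraction and comparison of integers; unit-cost addition, subtraction and multiplication of reals) such that for all $a,b,\kappa>0$ there is $C_0>0$ such that for every $K$ there is $C_2$ with the following property. Let $n\ge2$, $u\ge2$, $0<\varepsilon\le1$, and let $s\le d$ satisfy $$C_0\frac{\log n}{\varepsilon^2}\le d\le K\frac{\log n}{\varepsilon^2},\qquad \kappa\, d\varepsilon\le s\le K\,d\varepsilon .$$ 1. *Linearity.* For every outcome of the maps and every $0\le x\le u$, $\psi(x)=\pi_k(1^x0^{d2^k-x})$. That is, $\psi$ is the linear map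 $\pi_k$ applied to the unary encoding of $x$. 2. *Embedding of $\ell_1$ into $\ell_2^2$.* Suppose $\varepsilon k\le 1$. For all integers $0\le x,y\le u$, with probability at least $1-n^{-a}$, $$|x-y|=(1\pm C_1\varepsilon\log u)\,\|\psi(x)-\psi(y)\|^2 .$$ If moreover $u\le n^b$, then with probability at least $1-n^{-a}$ this holds simultaneously for all integers $0\le x,y\le u$. 3. *Running time.* Given $d,s,k,x$ and the maps $\varphi'_1,\dots,\varphi'_k$ (each column as the list of its nonzero positions and entries), the program computes $\psi(x)$, including the computation of $s_0,\dots,s_{k-1}$, in at most $C_2\,\dfrac{\log^2 n\,\log u}{\varepsilon^3}$ steps, for every outcome of the maps and every integer $0\le x\le u$. -/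

import Mathlib

open MeasureTheory ProbabilityTheory

noncomputable section

namespace L1Embedding

/-! ### Vectors -/

/-- `ℝ^N` with the Euclidean norm. -/
abbrev Vec (N : ℕ) : Type := EuclideanSpace ℝ (Fin N)

/-- The vector `(1, …, 1, 0, …, 0) ∈ ℝ^N` whose first `x` entries are ones. -/
def unary (N x : ℕ) : Vec N := WithLp.toLp 2 fun i => if (i : ℕ) < x then 1 else 0

/-- The linear map that extracts the `N` consecutive coordinates `off, …, off + N - 1`. -/
def block (M N off : ℕ) (h : off + N ≤ M) : Vec M →ₗ[ℝ] Vec N where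
  toFun v := WithLp.toLp 2 fun j => v ⟨off + j, by omega⟩
  map_add' _ _ := rfl
  map_smul' _ _ := rfl

/-- `A = (1 ± η) B`. -/
def ApproxEq (η A B : ℝ) : Prop := (1 - η) * B ≤ A ∧ A ≤ (1 + η) * B

/-! ### The sparse random maps `ℝ^d × ℝ^d → ℝ^d` -/

/-- The random choices for one column: the set of the `s` nonzero positions, and signs
(only those at the chosen positions are used). -/
def ColumnSeed (d s : ℕ) : Type := {S : Finset (Fin d) // S.card = s} × (Fin d → Bool)

instance (d s : ℕ) : Fintype (ColumnSeed d s) :=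
  inferInstanceAs (Fintype ({S : Finset (Fin d) // S.card = s} × (Fin d → Bool)))

instance (d s : ℕ) : MeasurableSpace (ColumnSeed d s) := ⊤

instance (d s : ℕ) : DiscreteMeasurableSpace (ColumnSeed d s) := ⟨fun _ => trivial⟩

/-- The set of nonzero positions of a column. -/
def ColumnSeed.rows {d s : ℕ} (q : ColumnSeed d s) : Finset (Fin d) := q.1.1

theorem ColumnSeed.card_rows {d s : ℕ} (q : ColumnSeed d s) : q.rows.card = s := q.1.2

/-- The value `± 1 / √s` that the column has at row `r` if `r` is one of its nonzero positions. -/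
def ColumnSeed.value {d s : ℕ} (q : ColumnSeed d s) (r : Fin d) : ℝ :=
  (if q.2 r then 1 else -1) / Real.sqrt s

/-- The random choices for one map `φ(x, y) = A₀ x + A₁ y`: one seed for each column `c` of
each of the two `d × d` matrices. -/
abbrev MapSeed (d s : ℕ) : Type := Fin 2 → Fin d → ColumnSeed d s

/-- The matrix `A_b`, with exactly `s` nonzero entries in each column. -/
def MapSeed.matrix {d s : ℕ} (q : MapSeed d s) (b : Fin 2) : Matrix (Fin d) (Fin d) ℝ :=
  Matrix.of fun r c => if r ∈ (q b c).rows then (q b c).value r else 0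

/-- The map `φ(x, y) = A₀ x + A₁ y`. -/
def MapSeed.toMap {d s : ℕ} (q : MapSeed d s) : Vec d × Vec d →ₗ[ℝ] Vec d :=
  (Matrix.toEuclideanLin (q.matrix 0)).coprod (Matrix.toEuclideanLin (q.matrix 1))

/-- The law of one column: the nonzero positions form a uniformly random set of size `s`, and
the signs are independent and uniform. -/
def columnLaw (d s : ℕ) : Measure (ColumnSeed d s) := uniformOn Set.univ

/-- The law of one map: all columns of both matrices are independent. -/
def mapLaw (d s : ℕ) : Measure (MapSeed d s) :=
  Measure.pi fun _ : Fin 2 => Measure.pi fun _ : Fin d => columnLaw d s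

/-- The law of `k` fully independent maps. -/
def mapsLaw (k d s : ℕ) : Measure (Fin k → MapSeed d s) :=
  Measure.pi fun _ : Fin k => mapLaw d s

/-! ### The procedures `Preprocess` and `Project`

The maps are `φ'_1, …, φ'_k`; here `φ'_{i+1}` is `φ i` for `i : Fin k`. -/

/-- The vectors `s_0 = (1, …, 1)`, `s_i = φ'_i (s_{i-1}, s_{i-1})`. -/
def preprocess {k d : ℕ} (φ : Fin k → (Vec d × Vec d →ₗ[ℝ] Vec d)) :
    (i : ℕ) → i ≤ k → Vec d
  | 0, _ => WithLp.toLp 2 fun _ => 1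
  | i + 1, h => φ ⟨i, h⟩ (preprocess φ i (by omega), preprocess φ i (by omega))

/-- The procedure `Project (x, c)`; note that `d * 2 ^ c` is half of `d * 2 ^ (c + 1)`. -/
def project {k d : ℕ} (φ : Fin k → (Vec d × Vec d →ₗ[ℝ] Vec d)) :
    (c : ℕ) → c ≤ k → ℕ → Vec d
  | 0, _, x => unary d x
  | c + 1, h, x =>
    if x < d * 2 ^ c then φ ⟨c, h⟩ (project φ c (by omega) x, 0)
    else φ ⟨c, h⟩ (preprocess φ c (by omega), project φ c (by omega) (x - d * 2 ^ c))

/-- The linear map `ℝ^(d 2^i) → ℝ^d` of recursive pairwise compression: both halves of the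
input are compressed recursively and the two results are compressed by `φ'_i`. -/
def compressAll {k d : ℕ} (φ : Fin k → (Vec d × Vec d →ₗ[ℝ] Vec d)) :
    (i : ℕ) → i ≤ k → (Vec (d * 2 ^ i) →ₗ[ℝ] Vec d)
  | 0, _ => block (d * 2 ^ 0) d 0 (by simp)
  | i + 1, h =>
    φ ⟨i, h⟩ ∘ₗ
      ((compressAll φ i (by omega) ∘ₗ
          block (d * 2 ^ (i + 1)) (d * 2 ^ i) 0 (by rw [pow_succ, ← mul_assoc]; omega)).prod
        (compressAll φ i (by omega) ∘ₗ
          block (d * 2 ^ (i + 1)) (d * 2 ^ i) (d * 2 ^ i) (by rw [pow_succ, ← mul_assoc]; omega)))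

/-- The number of levels `log₂ (u / d)`: the least `k` with `u ≤ d * 2 ^ k`. If `u / d` is not
a power of two, this amounts to padding with zeros. -/
def levels (d u : ℕ) : ℕ := Nat.clog 2 (u ⌈/⌉ d)

/-- The map `ψ(x) = Project (x, log₂ (u / d))`. -/
def psi {d s : ℕ} (u : ℕ) (q : Fin (levels d u) → MapSeed d s) (x : ℕ) : Vec d :=
  project (fun i => (q i).toMap) (levels d u) le_rfl x

/-! ### Running time: a real-number random access machine

The machine has integer registers and real registers, an integer memory and a real memory.
The memories are accessed indirectly, at an address that is held in an integer register.
Integers admit addition, truncated subtraction and comparison; reals admit addition,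
subtraction and multiplication. Every instruction and every test costs one step. -/

structure State where
  ireg : ℕ → ℕ
  rreg : ℕ → ℝ
  imem : ℕ → ℕ
  rmem : ℕ → ℝ

/-- The instructions. All arguments `t`, `a`, `b` are numbers of registers. -/
inductive Instr where
  | iconst (t c : ℕ)
  | iadd (t a b : ℕ)
  | isub (t a b : ℕ)
  | iload (t a : ℕ)
  | istore (a b : ℕ)
  | rconst (t : ℕ) (c : ℤ)
  | radd (t a b : ℕ)
  | rsub (t a b : ℕ)
  | rmul (t a b : ℕ)
  | rload (t a : ℕ)
  | rstore (a b : ℕ)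

/-- The effect of an instruction. -/
def Instr.exec (σ : State) : Instr → State
  | .iconst t c => { σ with ireg := Function.update σ.ireg t c }
  | .iadd t a b => { σ with ireg := Function.update σ.ireg t (σ.ireg a + σ.ireg b) }
  | .isub t a b => { σ with ireg := Function.update σ.ireg t (σ.ireg a - σ.ireg b) }
  | .iload t a => { σ with ireg := Function.update σ.ireg t (σ.imem (σ.ireg a)) }
  | .istore a b => { σ with imem := Function.update σ.imem (σ.ireg a) (σ.ireg b) }
  | .rconst t c => { σ with rreg := Function.update σ.rreg t (c : ℝ) }
  | .radd t a b => { σ with rreg := Function.update σ.rreg t (σ.rreg a + σ.rreg b) }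
  | .rsub t a b => { σ with rreg := Function.update σ.rreg t (σ.rreg a - σ.rreg b) }
  | .rmul t a b => { σ with rreg := Function.update σ.rreg t (σ.rreg a * σ.rreg b) }
  | .rload t a => { σ with rreg := Function.update σ.rreg t (σ.rmem (σ.ireg a)) }
  | .rstore a b => { σ with rmem := Function.update σ.rmem (σ.ireg a) (σ.rreg b) }

/-- Programs. The tests compare the contents of the integer registers `a` and `b`. -/
inductive Program where
  | instr (i : Instr)
  | seq (p q : Program)
  | ifLt (a b : ℕ) (p q : Program)
  | whileLt (a b : ℕ) (p : Program)

/-- `Runs p σ t σ'`: started in `σ`, the program `p` halts in `σ'` after exactly `t` steps. -/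
inductive Runs : Program → State → ℕ → State → Prop where
  | instr (i : Instr) (σ : State) : Runs (.instr i) σ 1 (i.exec σ)
  | seq {p q : Program} {σ₁ σ₂ σ₃ : State} {t₁ t₂ : ℕ} :
      Runs p σ₁ t₁ σ₂ → Runs q σ₂ t₂ σ₃ → Runs (.seq p q) σ₁ (t₁ + t₂) σ₃
  | ifTrue {a b : ℕ} {p q : Program} {σ σ' : State} {t : ℕ} :
      σ.ireg a < σ.ireg b → Runs p σ t σ' → Runs (.ifLt a b p q) σ (t + 1) σ'
  | ifFalse {a b : ℕ} {p q : Program} {σ σ' : State} {t : ℕ} :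
      ¬ σ.ireg a < σ.ireg b → Runs q σ t σ' → Runs (.ifLt a b p q) σ (t + 1) σ'
  | whileTrue {a b : ℕ} {p : Program} {σ₁ σ₂ σ₃ : State} {t₁ t₂ : ℕ} :
      σ₁.ireg a < σ₁.ireg b → Runs p σ₁ t₁ σ₂ → Runs (.whileLt a b p) σ₂ t₂ σ₃ →
      Runs (.whileLt a b p) σ₁ (t₁ + t₂ + 1) σ₃
  | whileFalse {a b : ℕ} {p : Program} {σ : State} :
      ¬ σ.ireg a < σ.ireg b → Runs (.whileLt a b p) σ 1 σ

/-- The machine state `σ` holds the input: `d`, `s`, the number `k` of levels and `x` are in the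
integer registers `0, 1, 2, 3`, and the `k` maps are stored in sparse form, that is, consecutively
for each level, each of the two matrices and each column, the `s` nonzero positions of the column
in increasing order (integer memory) together with the entries at these positions (real memory).
All other registers and memory cells may have any content. -/
def HoldsInput {k d s : ℕ} (q : Fin k → MapSeed d s) (x : ℕ) (σ : State) : Prop :=
  σ.ireg 0 = d ∧ σ.ireg 1 = s ∧ σ.ireg 2 = k ∧ σ.ireg 3 = x ∧
  ∀ (l : Fin k) (b : Fin 2) (c : Fin d) (j : Fin s),
    let addr : ℕ := ((l * 2 + b) * d + c) * s + j
    let r : Fin d := (q l b c).rows.orderEmbOfFin (q l b c).card_rows j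
    σ.imem addr = r ∧ σ.rmem addr = (q l b c).value r

/-- The machine state `σ` holds the output `v`: the entries of `v` are consecutive cells of the
real memory, starting at the address in the integer register `0`. -/
def HoldsOutput {d : ℕ} (v : Vec d) (σ : State) : Prop :=
  ∀ i : Fin d, σ.rmem (σ.ireg 0 + i) = v i

end L1Embedding

end

noncomputable section

namespace L1Embedding

open Finset
open scoped BigOperators

/-! Linearity. A block of a unary encoding is again a unary encoding. At each level of `project` one
half is either zero or full, and the compression of a full half is the preprocessed vector
(`project_eq`).

Distortion. For `y ≤ x` the difference of the encodings is the indicator of an interval. All blocks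
of one level are compressed by the same maps, so a level meets at most three distinct nonzero
inputs: the blocks holding the two end points, and a full block (`abs_dev_block_le`). If the
deviations on these three add up to at most `D i`, level `i` changes the total squared norm by a
factor within `1 ± D i`, and over all levels the distortion is governed by `∑ D i`
(`norm_compressUnary_sub_bounds`, `approxEq_of_sum_absDev_le`).

For one sparse map and a fixed vector the relative deviation is subgaussian with variance proxy of
order `1 / d`, for parameters up to `s / 8` (`MapSeed.expect_exp_dev_le`). Given the positions, the
rows are independent Rademacher chaoses without diagonal, because every column has norm exactly one.
Their joint bound is the exponential of an average of column overlaps, with weights `v i ^ 2 * v j ^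
2`. Convexity of `exp` then reduces everything to the overlap of two columns.

The input of level `i` depends on lower levels only, so this estimate applies to each of the `3 k`
deviations. Convexity, used once more, bounds the exponential moment of their mean by that of a
single one. Hence the failure probability carries no factor `k`, and `u` needs no bound in the claim
about one pair. Markov's inequality finishes that claim; a union bound over pairs gives the
simultaneous one.

Running time. The recursion is unrolled: its case distinctions are found from the top level down,
then the vectors are computed from the bottom up, with two sparse map applications of cost `O(d s)`
per level. Finally `d s` is of order `log² n / ε³` and the number of levels is `O(log u)`. -/

/-! ### Averages over finite product spaces -/

/-- Resampling one coordinate does not change an average over a finite product space. -/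
theorem expect_expect_update {ι Ω : Type*} [Fintype ι] [DecidableEq ι] [Fintype Ω] [Nonempty Ω]
    (j : ι) (f : (ι → Ω) → ℝ) :
    𝔼 q : ι → Ω, 𝔼 t : Ω, f (Function.update q j t) = 𝔼 q : ι → Ω, f q := by
  have h : 𝔼 p : (ι → Ω) × Ω, f (Function.update p.1 j p.2) = 𝔼 p : (ι → Ω) × Ω, f p.1 := by
    -- Exchanging the coordinate `j` with the fresh sample is an involution, so it preserves the
    -- uniform average.
    let e : (ι → Ω) × Ω → (ι → Ω) × Ω := fun p => (Function.update p.1 j p.2, p.1 j)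
    have he : Function.Involutive e := fun p => by simp [e]
    exact Fintype.expect_bijective e he.bijective _ _ fun p => rfl
  rw [← univ_product_univ, expect_product, expect_product] at h
  simpa using h

/-- The average of a product of functions of distinct coordinates is the product of averages. -/
theorem expect_prod_pi {ι Ω : Type*} [Fintype ι] [DecidableEq ι] [Fintype Ω]
    (f : ι → Ω → ℝ) : 𝔼 q : ι → Ω, ∏ i, f i (q i) = ∏ i, 𝔼 t : Ω, f i t := by
  simp only [Fintype.expect_eq_sum_div_card, prod_div_distrib, prod_univ_sum, Fintype.piFinset_univ]
  simp [prod_const, Fintype.card_pi]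

/-- The average of an exponential of a convex combination. -/
theorem expect_exp_sum_le {Ω ι : Type*} [Fintype Ω] [Nonempty Ω] (S : Finset ι) (w : ι → ℝ)
    (X : ι → Ω → ℝ) (hw : ∀ i ∈ S, 0 ≤ w i) (hw1 : ∑ i ∈ S, w i = 1) {B : ℝ}
    (hB : ∀ i ∈ S, w i ≠ 0 → 𝔼 q, Real.exp (X i q) ≤ B) :
    𝔼 q, Real.exp (∑ i ∈ S, w i * X i q) ≤ B := by
  calc 𝔼 q, Real.exp (∑ i ∈ S, w i * X i q) ≤ 𝔼 q, ∑ i ∈ S, w i * Real.exp (X i q) := by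
        refine expect_le_expect fun q _ => ?_
        simpa using convexOn_exp.map_sum_le (t := S) (w := w) (p := fun i => X i q) hw hw1
          (fun i _ => Set.mem_univ _)
    _ = ∑ i ∈ S, w i * 𝔼 q, Real.exp (X i q) := by
        rw [expect_sum_comm]; simp only [mul_expect]
    _ ≤ ∑ i ∈ S, w i * B := by
        refine sum_le_sum fun i hi => ?_
        by_cases h : w i = 0
        · simp [h]
        · exact mul_le_mul_of_nonneg_left (hB i hi h) (hw i hi)
    _ = B := by rw [← sum_mul, hw1, one_mul]

/-! ### Exponential moments of squares of Rademacher sums -/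

/-- The sign `± 1` encoded by a Boolean. -/
def sgn (b : Bool) : ℝ := if b then 1 else -1

/-- Expanding the square leaves `cosh (2 m c x)`, which is at most `exp ((2 m c x)² / 2)`. The bound
is again the exponential of a quadratic in `x`, so it can be iterated over the signs. -/
theorem expect_exp_sgn (m c x : ℝ) :
    𝔼 t : Bool, Real.exp (m * (x + c * sgn t) ^ 2)
      ≤ Real.exp (m * c ^ 2 + (m + 2 * (m * c) ^ 2) * x ^ 2) := by
  have h1 : 𝔼 t : Bool, Real.exp (m * (x + c * sgn t) ^ 2)
      = Real.exp (m * x ^ 2 + m * c ^ 2) * Real.cosh (2 * m * c * x) := by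
    rw [Fintype.expect_eq_sum_div_card, Real.cosh_eq]
    simp only [Fintype.univ_bool, Fintype.card_bool, sgn]
    rw [sum_pair (by simp), mul_div_assoc', mul_add, ← Real.exp_add, ← Real.exp_add]
    simp only [if_true, Bool.false_eq_true, if_false]
    push_cast
    congr 3 <;> ring_nf
  rw [h1]
  calc _ ≤ Real.exp (m * x ^ 2 + m * c ^ 2) * Real.exp ((2 * m * c * x) ^ 2 / 2) := by
        gcongr; exact Real.cosh_le_exp_half_sq _
    _ = _ := by rw [← Real.exp_add]; ring_nf

/-- The shift `x` is what makes the induction close: peeling off one sign turns `x` into `x ± a i`.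
The coefficient of `x ^ 2` grows with the signs already averaged, and the cross terms it produces
are exactly the increments of `A ^ 2 - Q`. -/
theorem expect_exp_sq_rademacher_finset {ι : Type*} [Fintype ι] [DecidableEq ι] (a : ι → ℝ)
    (l : ℝ) (F : Finset ι) : |l| * ∑ i ∈ F, a i ^ 2 ≤ 1 / 8 → ∀ x : ℝ,
    𝔼 τ : ι → Bool, Real.exp (l * (x + ∑ i ∈ F, a i * sgn (τ i)) ^ 2)
      ≤ Real.exp (l * ∑ i ∈ F, a i ^ 2
          + 4 * l ^ 2 * ((∑ i ∈ F, a i ^ 2) ^ 2 - ∑ i ∈ F, a i ^ 4)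
          + (l + 8 * l ^ 2 * ∑ i ∈ F, a i ^ 2) * x ^ 2) := by
  induction F using Finset.induction_on with
  | empty => intro _ x; simp
  | insert i F hi ih =>
    intro h x
    rw [sum_insert hi] at h
    have hA : 0 ≤ ∑ i ∈ F, a i ^ 2 := sum_nonneg fun i _ => sq_nonneg _
    have hF : |l| * ∑ i ∈ F, a i ^ 2 ≤ 1 / 8 :=
      le_trans (mul_le_mul_of_nonneg_left (by nlinarith [sq_nonneg (a i)]) (abs_nonneg l)) h
    rw [← expect_expect_update i, expect_comm]
    have hstep : ∀ t : Bool, 𝔼 τ : ι → Bool,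
        Real.exp (l * (x + ∑ j ∈ insert i F, a j * sgn (Function.update τ i t j)) ^ 2)
        = 𝔼 τ : ι → Bool,
          Real.exp (l * ((x + a i * sgn t) + ∑ j ∈ F, a j * sgn (τ j)) ^ 2) := by
      intro t
      refine expect_congr rfl fun τ _ => ?_
      rw [sum_insert hi, Function.update_self, add_assoc]
      congr 5
      refine sum_congr rfl fun j hj => ?_
      rw [Function.update_of_ne (by rintro rfl; exact hi hj)]
    simp only [hstep]
    rw [sum_insert hi, sum_insert hi]
    set A := ∑ i ∈ F, a i ^ 2
    set Q := ∑ i ∈ F, a i ^ 4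
    set m := l + 8 * l ^ 2 * A with hm
    -- The smallness hypothesis gives `|8 l A| ≤ 1`, so the running coefficient never exceeds `2
    -- |l|`.
    have hm2 : m ^ 2 ≤ 4 * l ^ 2 := by
      have : m ^ 2 = l ^ 2 * (1 + 8 * l * A) ^ 2 := by rw [hm]; ring
      rw [this, mul_comm]
      refine mul_le_mul_of_nonneg_right ?_ (sq_nonneg l)
      have h1 : |1 + 8 * l * A| ≤ 2 := by
        have : |l * A| ≤ 1 / 8 := by rwa [abs_mul, abs_of_nonneg hA]
        rw [abs_le] at this ⊢
        constructor <;> nlinarith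
      calc (1 + 8 * l * A) ^ 2 = |1 + 8 * l * A| ^ 2 := (sq_abs _).symm
        _ ≤ 2 ^ 2 := by gcongr
        _ = 4 := by norm_num
    calc _ ≤ 𝔼 t : Bool, Real.exp (l * A + 4 * l ^ 2 * (A ^ 2 - Q)
              + m * (x + a i * sgn t) ^ 2) := expect_le_expect fun t _ => ih hF _
      _ = Real.exp (l * A + 4 * l ^ 2 * (A ^ 2 - Q))
            * 𝔼 t : Bool, Real.exp (m * (x + a i * sgn t) ^ 2) := by
          simp only [Real.exp_add (l * A + _), mul_expect]
      _ ≤ Real.exp (l * A + 4 * l ^ 2 * (A ^ 2 - Q))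
            * Real.exp (m * a i ^ 2 + (m + 2 * (m * a i) ^ 2) * x ^ 2) := by
          gcongr; exact expect_exp_sgn _ _ _
      _ ≤ _ := by
          rw [← Real.exp_add, Real.exp_le_exp]
          have h2 : (m * a i) ^ 2 * x ^ 2 ≤ 4 * l ^ 2 * a i ^ 2 * x ^ 2 := by
            rw [mul_pow]; gcongr
          rw [hm] at *
          nlinarith

/-- The exponential moment of the off-diagonal part of the square of a Rademacher sum. -/
theorem expect_exp_sq_rademacher {ι : Type*} [Fintype ι] [DecidableEq ι] (a : ι → ℝ) (l : ℝ)
    (h : |l| * ∑ i, a i ^ 2 ≤ 1 / 8) :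
    𝔼 τ : ι → Bool, Real.exp (l * ((∑ i, a i * sgn (τ i)) ^ 2 - ∑ i, a i ^ 2))
      ≤ Real.exp (4 * l ^ 2 * ((∑ i, a i ^ 2) ^ 2 - ∑ i, a i ^ 4)) := by
  have := expect_exp_sq_rademacher_finset a l univ h 0
  simp only [zero_add, ne_eq, OfNat.ofNat_ne_zero, not_false_eq_true, zero_pow, mul_zero,
    add_zero, Real.exp_add (l * _)] at this
  simp only [mul_sub l, Real.exp_sub, ← expect_div]
  rw [div_le_iff₀ (Real.exp_pos _), mul_comm]
  exact this

/-! ### Intersections of random sets of fixed size -/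

/-- Factor by factor this is `(s - i) / (m - i) ≤ s / m`: drawing without replacement only lowers
the chance of another hit. -/
theorem descFactorial_mul_pow_le {m s : ℕ} (hs : s ≤ m) (r : ℕ) :
    s.descFactorial r * m ^ r ≤ m.descFactorial r * s ^ r := by
  induction r with
  | zero => simp
  | succ r ih =>
    rw [Nat.descFactorial_succ, Nat.descFactorial_succ, pow_succ, pow_succ]
    have h : (s - r) * m ≤ (m - r) * s := by
      rw [Nat.sub_mul, Nat.sub_mul, mul_comm m s]
      exact Nat.sub_le_sub_left (Nat.mul_le_mul_left r hs) _
    calc (s - r) * s.descFactorial r * (m ^ r * m)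
        = ((s - r) * m) * (s.descFactorial r * m ^ r) := by ring
      _ ≤ ((m - r) * s) * (m.descFactorial r * s ^ r) := Nat.mul_le_mul h ih
      _ = _ := by ring

/-- The sets of size `s`. -/
abbrev SubsetOf (d s : ℕ) : Type := {S : Finset (Fin d) // S.card = s}

theorem nonempty_subsetOf {d s : ℕ} (h : s ≤ d) : Nonempty (SubsetOf d s) := by
  obtain ⟨S, -, hS⟩ := exists_subset_card_eq (s := (univ : Finset (Fin d))) (n := s) (by simpa)
  exact ⟨⟨S, hS⟩⟩

theorem card_filter_superset_le {d s : ℕ} (R : Finset (Fin d)) :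
    (univ.filter fun T : SubsetOf d s => R ⊆ T.1).card ≤ (d - R.card).choose (s - R.card) := by
  have : (d - R.card).choose (s - R.card) = ((univ \ R).powersetCard (s - R.card)).card := by
    rw [card_powersetCard, card_univ_sdiff, Fintype.card_fin]
  rw [this]
  refine card_le_card_of_injOn (fun T => T.1 \ R) ?_ ?_
  · intro T hT
    have hT : R ⊆ T.1 := by simpa using hT
    simp only [mem_coe, mem_powersetCard]
    exact ⟨sdiff_subset_sdiff (subset_univ _) le_rfl, by rw [card_sdiff_of_subset hT, T.2]⟩
  · intro T hT T' hT' h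
    have hT : R ⊆ T.1 := by simpa using hT
    have hT' : R ⊆ T'.1 := by simpa using hT'
    have h : T.1 \ R = T'.1 \ R := h
    exact Subtype.ext (by rw [← sdiff_union_of_subset hT, h, sdiff_union_of_subset hT'])

/-- Inclusions of different points in a random set of fixed size are negatively correlated: the
probability is at most `(s)_r / (d)_r` with falling factorials, which is no larger than for
independent inclusions of probability `s / d`. -/
theorem expect_superset_le {d s : ℕ} (hs : s ≤ d) (hd : 0 < d) (R : Finset (Fin d)) :
    𝔼 T : SubsetOf d s, (if R ⊆ T.1 then (1 : ℝ) else 0) ≤ ((s : ℝ) / d) ^ R.card := by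
  have hR : R.card ≤ d := by simpa using card_le_univ R
  rw [Fintype.expect_eq_sum_div_card, sum_boole, Fintype.card_finset_len, Fintype.card_fin]
  have hc : 0 < d.choose s := Nat.choose_pos hs
  by_cases hRs : R.card ≤ s
  · rw [div_pow, div_le_div_iff₀ (by exact_mod_cast hc) (by positivity)]
    norm_cast
    refine (Nat.mul_le_mul_right _ (card_filter_superset_le R)).trans ?_
    have h1 := Nat.choose_mul (n := d) hRs
    have h2 := descFactorial_mul_pow_le hs R.card
    rw [Nat.descFactorial_eq_factorial_mul_choose, Nat.descFactorial_eq_factorial_mul_choose,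
      mul_assoc, mul_assoc] at h2
    have h2 := Nat.le_of_mul_le_mul_left h2 (Nat.factorial_pos _)
    refine Nat.le_of_mul_le_mul_left ?_ (Nat.choose_pos hR)
    calc d.choose R.card * ((d - R.card).choose (s - R.card) * d ^ R.card)
        = d.choose s * (s.choose R.card * d ^ R.card) := by rw [← mul_assoc, ← h1, mul_assoc]
      _ ≤ d.choose s * (d.choose R.card * s ^ R.card) := Nat.mul_le_mul_left _ h2
      _ = _ := by ring
  · have : (univ.filter fun T : SubsetOf d s => R ⊆ T.1) = ∅ := by
      refine filter_eq_empty_iff.2 fun T _ hT => hRs ?_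
      rw [← T.2]; exact card_le_card hT
    rw [this]; simp; positivity

/-- The exponential moment of the size of the intersection of a fixed set and a random set. -/
theorem expect_exp_inter_le {d s : ℕ} (hs : s ≤ d) (hd : 0 < d) (S : SubsetOf d s) {θ : ℝ}
    (h0 : 0 ≤ θ) (h1 : θ ≤ 1) :
    𝔼 T : SubsetOf d s, Real.exp (θ * (S.1 ∩ T.1).card) ≤ Real.exp (2 * θ * (s ^ 2 / d)) := by
  have hθ : 0 ≤ Real.exp θ - 1 := by linarith [Real.add_one_le_exp θ]
  have hθ2 : Real.exp θ - 1 ≤ 2 * θ := by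
    have := Real.abs_exp_sub_one_le (x := θ) (by rwa [abs_of_nonneg h0])
    rwa [abs_of_nonneg hθ, abs_of_nonneg h0] at this
  -- Writing `exp θ = 1 + (exp θ - 1)` and expanding the product over the intersection gives a sum
  -- over its subsets `R` with nonnegative coefficients, so bounds on inclusion probabilities
  -- suffice.
  have hexp : ∀ T : SubsetOf d s, Real.exp (θ * (S.1 ∩ T.1).card)
      = ∑ R ∈ S.1.powerset, (Real.exp θ - 1) ^ R.card * (if R ⊆ T.1 then (1 : ℝ) else 0) := by
    intro T
    have : Real.exp (θ * (S.1 ∩ T.1).card)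
        = ∏ _i ∈ S.1 ∩ T.1, (1 + (Real.exp θ - 1)) := by
      rw [prod_const, add_sub_cancel, mul_comm, Real.exp_nat_mul]
    rw [this, prod_one_add]
    simp only [prod_const, mul_ite, mul_one, mul_zero]
    rw [← sum_filter]
    refine sum_congr ?_ fun _ _ => rfl
    ext R
    simp only [mem_powerset, mem_filter, subset_inter_iff]
  simp only [hexp]
  rw [expect_sum_comm]
  simp only [← mul_expect]
  calc _ ≤ ∑ R ∈ S.1.powerset, (Real.exp θ - 1) ^ R.card * ((s : ℝ) / d) ^ R.card := by
        gcongr; exact expect_superset_le hs hd _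
    _ = (1 + (Real.exp θ - 1) * (s / d)) ^ s := by
        simp only [← mul_pow]
        have := prod_one_add (f := fun _ : Fin d => (Real.exp θ - 1) * ((s : ℝ) / d)) S.1
        simp only [prod_const] at this
        rw [← this, S.2]
    _ ≤ Real.exp ((Real.exp θ - 1) * (s / d)) ^ s := by
        gcongr
        rw [add_comm]; exact Real.add_one_le_exp _
    _ = Real.exp ((Real.exp θ - 1) * (s ^ 2 / d)) := by
        rw [← Real.exp_nat_mul]; ring_nf
    _ ≤ _ := by gcongr

/-! ### Exponential moments of one sparse map -/

/-- `s` times the squared norm of the image of `v` under the sparse matrix with nonzero positions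
`S` and signs `σ`. -/
def sparseQuad {ι : Type*} [Fintype ι] {d s : ℕ} (S : ι → SubsetOf d s) (σ : Fin d → ι → Bool)
    (v : ι → ℝ) : ℝ :=
  ∑ r, (∑ i, (if r ∈ (S i).1 then v i else 0) * sgn (σ r i)) ^ 2

/-- Each column has exactly `s` nonzero positions. With `w i = v i ^ 2` this shows that the diagonal
part of the quadratic form is not random. -/
theorem sum_sum_ite_mem {ι : Type*} [Fintype ι] {d s : ℕ} (S : ι → SubsetOf d s) (w : ι → ℝ) :
    ∑ r : Fin d, ∑ i, (if r ∈ (S i).1 then w i else 0) = s * ∑ i, w i := by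
  rw [sum_comm, mul_sum]
  refine sum_congr rfl fun i _ => ?_
  rw [← sum_filter, sum_const, nsmul_eq_mul]
  congr 2
  rw [filter_univ_mem, (S i).2]

/-- Two distinct columns contribute once for each row that they share. The row-wise bounds thereby
become a combination of overlaps whose weights `v i ^ 2 * v j ^ 2` sum to one for a unit vector. -/
theorem sum_offDiag_eq {ι : Type*} [Fintype ι] [DecidableEq ι] {d s : ℕ} (S : ι → SubsetOf d s)
    (v : ι → ℝ) :
    ∑ r : Fin d, ((∑ i, (if r ∈ (S i).1 then v i else 0) ^ 2) ^ 2
        - ∑ i, (if r ∈ (S i).1 then v i else 0) ^ 4)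
      = ∑ p : ι × ι, v p.1 ^ 2 * v p.2 ^ 2 *
          (if p.1 = p.2 then 0 else (((S p.1).1 ∩ (S p.2).1).card : ℝ)) := by
  have h1 : ∀ p : ι × ι, (if p.1 = p.2 then 0 else (((S p.1).1 ∩ (S p.2).1).card : ℝ))
      = ∑ r : Fin d, if p.1 = p.2 then 0 else
          if r ∈ (S p.1).1 ∧ r ∈ (S p.2).1 then (1 : ℝ) else 0 := by
    intro p
    split_ifs with h
    · simp
    · simp only [← mem_inter]
      rw [← sum_filter, sum_const, nsmul_eq_mul, mul_one, filter_univ_mem]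
  simp only [h1, mul_sum]
  rw [sum_comm]
  refine sum_congr rfl fun r _ => ?_
  rw [sq (∑ i, _), sum_mul_sum, ← univ_product_univ, sum_product, ← sum_sub_distrib]
  refine sum_congr rfl fun i _ => ?_
  have : (if r ∈ (S i).1 then v i else 0) ^ 4
      = ∑ j, if i = j then (if r ∈ (S i).1 then v i else 0) ^ 4 else 0 := by simp
  rw [this, ← sum_sub_distrib]
  refine sum_congr rfl fun j _ => ?_
  by_cases h : i = j
  · subst h; simp; split_ifs <;> ring
  · by_cases h2 : r ∈ (S i).1 <;> by_cases h3 : r ∈ (S j).1 <;> simp [h, h2, h3]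

/-- For fixed positions the rows use disjoint sets of signs, so the average factorizes and
`expect_exp_sq_rademacher` applies to each row. The subtracted `s` is the sum of the diagonal terms.
-/
theorem expect_sign_exp_le {ι : Type*} [Fintype ι] [DecidableEq ι] {d s : ℕ}
    (S : ι → SubsetOf d s) (v : ι → ℝ) (hv : ∑ i, v i ^ 2 = 1) {θ : ℝ} (hθ : |θ| ≤ 1 / 8) :
    𝔼 σ : Fin d → ι → Bool, Real.exp (θ * (sparseQuad S σ v - s))
      ≤ Real.exp (∑ p : ι × ι, v p.1 ^ 2 * v p.2 ^ 2 *
          (4 * θ ^ 2 * (if p.1 = p.2 then 0 else (((S p.1).1 ∩ (S p.2).1).card : ℝ)))) := by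
  have hs : ∑ r : Fin d, ∑ i, (if r ∈ (S i).1 then v i else 0) ^ 2 = s := by
    have := sum_sum_ite_mem S fun i => v i ^ 2
    rw [hv, mul_one] at this
    rw [← this]
    refine sum_congr rfl fun r _ => sum_congr rfl fun i _ => ?_
    split_ifs <;> simp
  have hsplit : ∀ σ : Fin d → ι → Bool, Real.exp (θ * (sparseQuad S σ v - s))
      = ∏ r, Real.exp (θ * ((∑ i, (if r ∈ (S i).1 then v i else 0) * sgn (σ r i)) ^ 2
          - ∑ i, (if r ∈ (S i).1 then v i else 0) ^ 2)) := by
    intro σ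
    rw [← Real.exp_sum, ← mul_sum, sum_sub_distrib, hs, sparseQuad]
  simp only [hsplit]
  rw [expect_prod_pi (fun r (τ : ι → Bool) =>
    Real.exp (θ * ((∑ i, (if r ∈ (S i).1 then v i else 0) * sgn (τ i)) ^ 2
          - ∑ i, (if r ∈ (S i).1 then v i else 0) ^ 2)))]
  calc _ ≤ ∏ r : Fin d, Real.exp (4 * θ ^ 2 *
            ((∑ i, (if r ∈ (S i).1 then v i else 0) ^ 2) ^ 2
              - ∑ i, (if r ∈ (S i).1 then v i else 0) ^ 4)) := by
        refine prod_le_prod (fun r _ => ?_) fun r _ => ?_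
        · exact expect_nonneg fun _ _ => (Real.exp_pos _).le
        · refine expect_exp_sq_rademacher _ _ ?_
          calc _ ≤ |θ| * ∑ i, v i ^ 2 := by
                refine mul_le_mul_of_nonneg_left (sum_le_sum fun i _ => ?_) (abs_nonneg θ)
                split_ifs
                · exact le_rfl
                · simp [sq_nonneg]
            _ ≤ 1 / 8 := by rw [hv, mul_one]; exact hθ
    _ = _ := by
        rw [← Real.exp_sum, ← mul_sum, sum_offDiag_eq, mul_sum]
        congr 1
        refine sum_congr rfl fun p _ => by ring

/-- The exponent left after averaging the signs is a convex combination of overlaps. By convexity it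
is enough to treat one pair of columns, so the dependence between different overlaps is irrelevant.
-/
theorem expect_exp_sparseQuad_le {ι : Type*} [Fintype ι] [DecidableEq ι] {d s : ℕ} (hsd : s ≤ d)
    (hd : 0 < d) (v : ι → ℝ) (hv : ∑ i, v i ^ 2 = 1) {θ : ℝ} (hθ : |θ| ≤ 1 / 8) :
    𝔼 S : ι → SubsetOf d s, 𝔼 σ : Fin d → ι → Bool, Real.exp (θ * (sparseQuad S σ v - s))
      ≤ Real.exp (8 * θ ^ 2 * (s ^ 2 / d)) := by
  have : Nonempty (SubsetOf d s) := nonempty_subsetOf hsd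
  have hθ2 : θ ^ 2 ≤ 1 / 64 := by
    calc θ ^ 2 = |θ| ^ 2 := (sq_abs _).symm
      _ ≤ (1 / 8) ^ 2 := by gcongr
      _ = 1 / 64 := by norm_num
  refine (expect_le_expect fun S _ => expect_sign_exp_le S v hv hθ).trans ?_
  refine expect_exp_sum_le univ (fun p : ι × ι => v p.1 ^ 2 * v p.2 ^ 2)
    (fun p (S : ι → SubsetOf d s) =>
      4 * θ ^ 2 * (if p.1 = p.2 then 0 else (((S p.1).1 ∩ (S p.2).1).card : ℝ)))
    (fun p _ => by positivity) ?_ ?_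
  · rw [← univ_product_univ, sum_product]
    simp only
    rw [← sum_mul_sum, hv, one_mul]
  · rintro ⟨i, j⟩ - -
    by_cases h : i = j
    · simp only [h, if_true, mul_zero, Real.exp_zero]
      rw [Fintype.expect_const]
      exact Real.one_le_exp (by positivity)
    · simp only [h, if_false]
      -- Only the set of column `j` is resampled, so the other set is fixed and
      -- `expect_exp_inter_le` applies with parameter `4 * θ ^ 2 ≤ 1 / 16`.
      rw [← expect_expect_update j]
      refine expect_le univ_nonempty fun S _ => ?_
      simp only [Function.update_of_ne h, Function.update_self]
      refine (expect_exp_inter_le hsd hd (S i) (by positivity) (by linarith)).trans_eq ?_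
      ring_nf

/-- A seed for a map as the positions and, for each row, the signs. -/
def MapSeed.equiv (d s : ℕ) :
    MapSeed d s ≃ (Fin 2 × Fin d → SubsetOf d s) × (Fin d → Fin 2 × Fin d → Bool) where
  toFun q := (fun p => (q p.1 p.2).1, fun r p => (q p.1 p.2).2 r)
  invFun p := fun b c => (p.1 (b, c), fun r => p.2 r (b, c))
  left_inv _ := rfl
  right_inv _ := rfl

theorem MapSeed.equiv_fst {d s : ℕ} (q : MapSeed d s) (p : Fin 2 × Fin d) :
    (MapSeed.equiv d s q).1 p = (q p.1 p.2).1 := rfl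

theorem MapSeed.equiv_snd {d s : ℕ} (q : MapSeed d s) (r : Fin d) (p : Fin 2 × Fin d) :
    (MapSeed.equiv d s q).2 r p = (q p.1 p.2).2 r := rfl

/-- The coordinates of a pair of vectors. -/
def pairCoord {d : ℕ} (v : Vec d × Vec d) (p : Fin 2 × Fin d) : ℝ :=
  if p.1 = 0 then v.1 p.2 else v.2 p.2

/-- The squared Euclidean norm of a pair of vectors. -/
def pairNormSq {d : ℕ} (v : Vec d × Vec d) : ℝ := ‖v.1‖ ^ 2 + ‖v.2‖ ^ 2

theorem sum_pairCoord_sq {d : ℕ} (v : Vec d × Vec d) : ∑ p, pairCoord v p ^ 2 = pairNormSq v := by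
  rw [← univ_product_univ, sum_product, Fin.sum_univ_two, pairNormSq, EuclideanSpace.norm_sq_eq,
    EuclideanSpace.norm_sq_eq]
  simp [pairCoord]

theorem MapSeed.norm_toMap_sq {d s : ℕ} (q : MapSeed d s) (v : Vec d × Vec d) :
    ‖q.toMap v‖ ^ 2
      = sparseQuad (MapSeed.equiv d s q).1 (MapSeed.equiv d s q).2 (pairCoord v) / s := by
  rw [EuclideanSpace.norm_sq_eq, sparseQuad, sum_div]
  refine sum_congr rfl fun r _ => ?_
  have hs : ((s : ℝ)) = Real.sqrt s ^ 2 := (Real.sq_sqrt (Nat.cast_nonneg s)).symm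
  rw [Real.norm_eq_abs, sq_abs]
  conv_rhs => rw [hs, ← div_pow]
  congr 1
  rw [sum_div, ← univ_product_univ, sum_product, Fin.sum_univ_two]
  simp only [MapSeed.toMap, LinearMap.coprod_apply, PiLp.add_apply, Matrix.toLpLin_apply,
    Matrix.mulVec, dotProduct, MapSeed.matrix, Matrix.of_apply]
  congr 1 <;> refine sum_congr rfl fun c _ => ?_
  · rw [MapSeed.equiv_fst, MapSeed.equiv_snd]
    by_cases h : r ∈ (q 0 c).rows
    · have h' : r ∈ (q 0 c).1.1 := h
      simp only [pairCoord, if_pos h, if_pos h', if_true, ColumnSeed.value,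
        sgn]
      ring
    · have h' : r ∉ (q 0 c).1.1 := h
      simp only [if_neg h, if_neg h', zero_mul, zero_div]
  · rw [MapSeed.equiv_fst, MapSeed.equiv_snd]
    by_cases h : r ∈ (q 1 c).rows
    · have h' : r ∈ (q 1 c).1.1 := h
      simp only [pairCoord, if_pos h, if_pos h', one_ne_zero, if_false, ColumnSeed.value,
        sgn]
      ring
    · have h' : r ∉ (q 1 c).1.1 := h
      simp only [if_neg h, if_neg h', zero_mul, zero_div]

/-- The relative deviation of the squared norm. -/
def MapSeed.dev {d s : ℕ} (q : MapSeed d s) (v : Vec d × Vec d) : ℝ :=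
  (‖q.toMap v‖ ^ 2 - pairNormSq v) / pairNormSq v

theorem nonempty_columnSeed {d s : ℕ} (h : s ≤ d) : Nonempty (ColumnSeed d s) :=
  (nonempty_subsetOf h).map fun S => (S, fun _ => true)

/-- The deviation is invariant under scaling, so the vector can be normalized; the factor `1 / s` in
the squared norm makes the parameter `θ = l / s`, and `8 θ² s² / d = 8 l² / d`. -/
theorem MapSeed.expect_exp_dev_le {d s : ℕ} (hsd : s ≤ d) (hs : 0 < s) (v : Vec d × Vec d)
    {l : ℝ} (hl : |l| ≤ s / 8) :
    𝔼 q : MapSeed d s, Real.exp (l * q.dev v) ≤ Real.exp (8 * l ^ 2 / d) := by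
  have hd : 0 < d := hs.trans_le hsd
  have : Nonempty (ColumnSeed d s) := nonempty_columnSeed hsd
  have hs' : (0 : ℝ) < s := by exact_mod_cast hs
  by_cases hv : pairNormSq v = 0
  · simp only [MapSeed.dev, hv, div_zero, mul_zero, Real.exp_zero]
    rw [Fintype.expect_const]
    exact Real.one_le_exp (by positivity)
  have hN : 0 < pairNormSq v := lt_of_le_of_ne (by unfold pairNormSq; positivity) (Ne.symm hv)
  set w : Fin 2 × Fin d → ℝ := fun p => pairCoord v p / Real.sqrt (pairNormSq v) with hw
  have hw1 : ∑ p, w p ^ 2 = 1 := by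
    simp only [hw, div_pow, Real.sq_sqrt hN.le]
    rw [← sum_div, sum_pairCoord_sq, div_self hv]
  have hθ : |l / s| ≤ 1 / 8 := by
    rw [abs_div, abs_of_pos hs', div_le_iff₀ hs']; linarith
  have key := expect_exp_sparseQuad_le hsd hd w hw1 hθ
  rw [← expect_product', univ_product_univ] at key
  rw [Fintype.expect_equiv (MapSeed.equiv d s) (fun q => Real.exp (l * q.dev v))
    (fun p => Real.exp (l / s * (sparseQuad p.1 p.2 w - s)))]
  · refine key.trans_eq ?_
    congr 1
    field_simp
  · intro q
    congr 1
    rw [MapSeed.dev, MapSeed.norm_toMap_sq]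
    have : sparseQuad (MapSeed.equiv d s q).1 (MapSeed.equiv d s q).2 w
        = sparseQuad (MapSeed.equiv d s q).1 (MapSeed.equiv d s q).2 (pairCoord v)
          / pairNormSq v := by
      rw [sparseQuad, sparseQuad, sum_div]
      refine sum_congr rfl fun r _ => ?_
      conv_rhs => rw [← Real.sq_sqrt hN.le, ← div_pow, sum_div]
      congr 1
      refine sum_congr rfl fun p _ => ?_
      simp only [hw]
      split_ifs <;> ring
    rw [this]
    field_simp

/-! ### The procedures as linear maps on unary encodings -/

/-- Truncated subtraction and the saturation of `unary` at its length cover the blocks after and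
before the end point. Hence every block of every level is described by one number. -/
theorem block_unary {M N off : ℕ} (h : off + N ≤ M) (x : ℕ) :
    block M N off h (unary M x) = unary N (x - off) := by
  ext j
  change (if off + (j : ℕ) < x then (1 : ℝ) else 0) = if (j : ℕ) < x - off then 1 else 0
  exact if_congr ⟨fun h => by omega, fun h => by omega⟩ rfl rfl

theorem unary_of_le {N x : ℕ} (h : N ≤ x) : unary N x = unary N N := by
  ext j
  simp [unary, j.2.trans_le h]

theorem unary_zero (N : ℕ) : unary N 0 = 0 := by
  ext j
  simp [unary]

section Compress

variable {k d : ℕ} (φ : Fin k → (Vec d × Vec d →ₗ[ℝ] Vec d))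

/-- The recursively compressed unary encoding of `min x (d * 2 ^ c)`. -/
def compressUnary (c : ℕ) (h : c ≤ k) (x : ℕ) : Vec d :=
  compressAll φ c h (unary (d * 2 ^ c) x)

theorem compressUnary_zero (h : 0 ≤ k) (x : ℕ) : compressUnary φ 0 h x = unary d x := by
  rw [compressUnary, compressAll, block_unary, Nat.sub_zero]

theorem compressUnary_succ (c : ℕ) (h : c + 1 ≤ k) (x : ℕ) :
    compressUnary φ (c + 1) h x = φ ⟨c, h⟩
      (compressUnary φ c (by omega) x, compressUnary φ c (by omega) (x - d * 2 ^ c)) := by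
  simp only [compressUnary, compressAll, LinearMap.comp_apply, LinearMap.prod_apply,
    Function.prod_apply, block_unary, Nat.sub_zero]

theorem compressUnary_of_le {c : ℕ} (h : c ≤ k) {x : ℕ} (hx : d * 2 ^ c ≤ x) :
    compressUnary φ c h x = compressUnary φ c h (d * 2 ^ c) := by
  rw [compressUnary, unary_of_le hx, compressUnary]

theorem compressUnary_at_zero {c : ℕ} (h : c ≤ k) : compressUnary φ c h 0 = 0 := by
  rw [compressUnary, unary_zero, map_zero]

theorem preprocess_eq (c : ℕ) (h : c ≤ k) :
    preprocess φ c h = compressUnary φ c h (d * 2 ^ c) := by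
  induction c with
  | zero => rw [preprocess, compressUnary_zero]; ext j; simp [unary]
  | succ c ih =>
    have h2 : d * 2 ^ (c + 1) = d * 2 ^ c + d * 2 ^ c := by ring
    rw [preprocess, compressUnary_succ, ih, h2, Nat.add_sub_cancel,
      compressUnary_of_le φ _ (Nat.le_add_left _ _)]

/-- If `x` lies in the left half, the right half is zero. Otherwise the left half is full and its
compression is the preprocessed vector. -/
theorem project_eq (c : ℕ) (h : c ≤ k) (x : ℕ) (hx : x ≤ d * 2 ^ c) :
    project φ c h x = compressUnary φ c h x := by
  induction c generalizing x with
  | zero => rw [project, compressUnary_zero]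
  | succ c ih =>
    have h2 : d * 2 ^ (c + 1) = d * 2 ^ c + d * 2 ^ c := by ring
    rw [project, compressUnary_succ]
    split_ifs with hlt
    · rw [ih _ _ hlt.le, Nat.sub_eq_zero_of_le hlt.le, compressUnary_at_zero]
    · rw [ih _ _ (by omega), preprocess_eq, ← compressUnary_of_le φ _ (not_lt.1 hlt)]

theorem compressUnary_congr (φ' : Fin k → (Vec d × Vec d →ₗ[ℝ] Vec d)) (c : ℕ) (h : c ≤ k)
    (hφ : ∀ i : Fin k, (i : ℕ) < c → φ i = φ' i) (x : ℕ) :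
    compressUnary φ c h x = compressUnary φ' c h x := by
  induction c generalizing x with
  | zero => rw [compressUnary_zero, compressUnary_zero]
  | succ c ih =>
    rw [compressUnary_succ, compressUnary_succ, hφ ⟨c, h⟩ (Nat.lt_succ_self c),
      ih _ fun i hi => hφ i (by omega), ih _ fun i hi => hφ i (by omega)]

/-- The pair that `φ i` is applied to in the block of `1^x 0⋯ - 1^y 0⋯`. -/
def blockPair (i : Fin k) (y x : ℕ) : Vec d × Vec d :=
  (compressUnary φ i i.2.le x - compressUnary φ i i.2.le y,
    compressUnary φ i i.2.le (x - d * 2 ^ (i : ℕ)) -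
      compressUnary φ i i.2.le (y - d * 2 ^ (i : ℕ)))

theorem compressUnary_succ_sub (i : Fin k) (y x : ℕ) :
    compressUnary φ (i + 1) i.2 x - compressUnary φ (i + 1) i.2 y = φ i (blockPair φ i y x) := by
  rw [compressUnary_succ, compressUnary_succ, ← map_sub]
  rfl

theorem blockPair_congr_of_le (i : Fin k) {y y' x x' : ℕ} (hy : y = y' ∨
    (d * 2 ^ (i + 1 : ℕ) ≤ y ∧ d * 2 ^ (i + 1 : ℕ) ≤ y')) (hx : x = x' ∨
    (d * 2 ^ (i + 1 : ℕ) ≤ x ∧ d * 2 ^ (i + 1 : ℕ) ≤ x')) :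
    blockPair φ i y x = blockPair φ i y' x' := by
  have h2 : d * 2 ^ (i + 1 : ℕ) = d * 2 ^ (i : ℕ) + d * 2 ^ (i : ℕ) := by ring
  have key : ∀ z z', (z = z' ∨ (d * 2 ^ (i + 1 : ℕ) ≤ z ∧ d * 2 ^ (i + 1 : ℕ) ≤ z')) →
      compressUnary φ i i.2.le z = compressUnary φ i i.2.le z' ∧
      compressUnary φ i i.2.le (z - d * 2 ^ (i : ℕ))
        = compressUnary φ i i.2.le (z' - d * 2 ^ (i : ℕ)) := by
    rintro z z' (rfl | ⟨h, h'⟩)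
    · exact ⟨rfl, rfl⟩
    · rw [compressUnary_of_le φ _ (x := z) (by omega), compressUnary_of_le φ _ (x := z') (by omega),
        compressUnary_of_le φ _ (x := z - _) (by omega),
        compressUnary_of_le φ _ (x := z' - _) (by omega)]
      exact ⟨rfl, rfl⟩
  rw [blockPair, blockPair, (key _ _ hy).1, (key _ _ hy).2, (key _ _ hx).1, (key _ _ hx).2]

/-- The input of level `i` involves only the maps of lower levels. This is the independence that
allows `φ i` to be resampled while its input stays fixed. -/
theorem blockPair_congr (φ' : Fin k → (Vec d × Vec d →ₗ[ℝ] Vec d)) (i : Fin k)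
    (hφ : ∀ j : Fin k, (j : ℕ) < i → φ j = φ' j) (y x : ℕ) :
    blockPair φ i y x = blockPair φ' i y x := by
  simp only [blockPair, compressUnary_congr φ φ' i i.2.le hφ]

end Compress

/-! ### Accumulated distortion -/

theorem pairNormSq_nonneg {d : ℕ} (v : Vec d × Vec d) : 0 ≤ pairNormSq v := by
  unfold pairNormSq; positivity

theorem MapSeed.norm_sq_eq {d s : ℕ} (q : MapSeed d s) (v : Vec d × Vec d) :
    ‖q.toMap v‖ ^ 2 = (1 + q.dev v) * pairNormSq v := by
  by_cases hv : pairNormSq v = 0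
  · have h1 : ‖v.1‖ ^ 2 = 0 := by
      have := sq_nonneg ‖v.2‖; have := sq_nonneg ‖v.1‖; unfold pairNormSq at hv; linarith
    have h2 : ‖v.2‖ ^ 2 = 0 := by
      have := sq_nonneg ‖v.2‖; have := sq_nonneg ‖v.1‖; unfold pairNormSq at hv; linarith
    have : v = 0 := Prod.ext (by simpa using h1) (by simpa using h2)
    rw [hv, this]; simp
  · rw [MapSeed.dev]; field_simp; ring

theorem MapSeed.dev_zero {d s : ℕ} (q : MapSeed d s) : q.dev 0 = 0 := by
  simp [MapSeed.dev, pairNormSq]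

theorem norm_unary_sub_sq {N x y : ℕ} (h : y ≤ x) :
    ‖unary N x - unary N y‖ ^ 2 = (min x N : ℕ) - (min y N : ℕ) := by
  have hcard : ∀ z : ℕ, ((min z N : ℕ) : ℝ) = ∑ j : Fin N, if (j : ℕ) < z then (1 : ℝ) else 0 := by
    intro z
    rw [sum_boole, Fin.card_filter_val_lt, min_comm]
  rw [EuclideanSpace.norm_sq_eq, hcard, hcard, ← sum_sub_distrib]
  refine sum_congr rfl fun j _ => ?_
  simp only [unary, PiLp.sub_apply]
  split_ifs <;> first | omega | norm_num

section Distortion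

variable {k d s : ℕ} (q : Fin k → MapSeed d s)

/-- The three kinds of nonzero blocks: those that contain one of the two end points, and those
that are contained in the interval. -/
def devBlock (y x : ℕ) (i : Fin k) (m : Fin 3) : ℕ × ℕ :=
  let H := d * 2 ^ (i + 1 : ℕ)
  ![(y - x / H * H, x - x / H * H), (y - y / H * H, x - y / H * H), (0, H)] m

/-- The absolute deviation of the map of level `i` on a block of the given kind. -/
def absDev (y x : ℕ) (p : Fin k × Fin 3) : ℝ :=
  |(q p.1).dev (blockPair (fun i => (q i).toMap) p.1 (devBlock (d := d) y x p.1 p.2).1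
    (devBlock (d := d) y x p.1 p.2).2)|

theorem absDev_nonneg (y x : ℕ) (p : Fin k × Fin 3) : 0 ≤ absDev q y x p := abs_nonneg _

/-- A block with neither end point in it is disjoint from the interval, where the deviation is zero,
or contained in it, where it is the one of the full block. So one bound per level serves all blocks
at once. -/
theorem abs_dev_block_le (hd : 0 < d) {y x : ℕ} (hyx : y ≤ x) (i : Fin k) (j : ℕ) :
    |(q i).dev (blockPair (fun i => (q i).toMap) i (y - j * (d * 2 ^ (i + 1 : ℕ)))
      (x - j * (d * 2 ^ (i + 1 : ℕ))))| ≤ ∑ m, absDev q y x (i, m) := by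
  have hle : ∀ m, absDev q y x (i, m) ≤ ∑ m, absDev q y x (i, m) := fun m =>
    single_le_sum (f := fun m => absDev q y x (i, m)) (fun m _ => absDev_nonneg q y x _)
      (mem_univ m)
  have hH : 0 < d * 2 ^ (i + 1 : ℕ) := by positivity
  have h0 : 0 ≤ ∑ m, absDev q y x (i, m) := sum_nonneg fun m _ => absDev_nonneg q y x _
  by_cases hjx : x / (d * 2 ^ (i + 1 : ℕ)) = j
  · rw [← hjx]; exact hle 0
  by_cases hjy : y / (d * 2 ^ (i + 1 : ℕ)) = j
  · rw [← hjy]; exact hle 1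
  have hfull := hle 2
  simp only [absDev, devBlock, Matrix.cons_val] at hfull
  set H := d * 2 ^ (i + 1 : ℕ) with hHdef
  have cases : ∀ z, z / H ≠ j → z - j * H = 0 ∨ H ≤ z - j * H := by
    intro z hz
    rcases lt_or_gt_of_ne hz with h | h
    · left
      have := (Nat.div_lt_iff_lt_mul hH).1 h
      omega
    · right
      have := (Nat.le_div_iff_mul_le hH).1 h
      rw [Nat.succ_mul] at this
      omega
  have hzero : ∀ z, blockPair (fun i => (q i).toMap) i z z = 0 := fun z => by simp [blockPair]
  -- The end points lie before or after the block. Both before or both after gives the zero vector,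
  -- `x` before and `y` after contradicts `y ≤ x`, and the remaining case is the full block.
  rcases cases x hjx with hx | hx <;> rcases cases y hjy with hy | hy
  · rw [hx, hy, hzero, MapSeed.dev_zero, abs_zero]; exact h0
  · omega
  · rw [blockPair_congr_of_le _ i (y' := 0) (x' := H) (Or.inl hy) (Or.inr ⟨hx, le_rfl⟩)]
    exact hfull
  · rw [blockPair_congr_of_le _ i (y' := x - j * H) (x' := x - j * H) (Or.inr ⟨hy, hx⟩)
      (Or.inl rfl), hzero, MapSeed.dev_zero, abs_zero]
    exact h0

/-- Squared norms and lengths both add over the two halves of a block, so a common factor for all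
blocks of level `c` passes to level `c + 1` and only gains `1 ± D c`. The bound `D i ≤ 1` keeps the
lower factors nonnegative. -/
theorem norm_compressUnary_sub_bounds (hd : 0 < d) {y x : ℕ} (hyx : y ≤ x)
    (D : ℕ → ℝ) (hD : ∀ i : Fin k, ∑ m, absDev q y x (i, m) ≤ D i) (hD1 : ∀ i, D i ≤ 1)
    (c : ℕ) (hc : c ≤ k) (j : ℕ) :
    (∏ i ∈ range c, (1 - D i)) *
        ((min (x - j * (d * 2 ^ c)) (d * 2 ^ c) : ℕ) - (min (y - j * (d * 2 ^ c)) (d * 2 ^ c) : ℕ))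
      ≤ ‖compressUnary (fun i => (q i).toMap) c hc (x - j * (d * 2 ^ c))
          - compressUnary (fun i => (q i).toMap) c hc (y - j * (d * 2 ^ c))‖ ^ 2 ∧
    ‖compressUnary (fun i => (q i).toMap) c hc (x - j * (d * 2 ^ c))
          - compressUnary (fun i => (q i).toMap) c hc (y - j * (d * 2 ^ c))‖ ^ 2
      ≤ (∏ i ∈ range c, (1 + D i)) *
        ((min (x - j * (d * 2 ^ c)) (d * 2 ^ c) : ℕ) -
          (min (y - j * (d * 2 ^ c)) (d * 2 ^ c) : ℕ)) := by
  induction c generalizing j with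
  | zero =>
    rw [compressUnary_zero, compressUnary_zero, norm_unary_sub_sq (by omega)]
    simp
  | succ c ih =>
    have hDc : 0 ≤ D c := (sum_nonneg fun m _ => absDev_nonneg q y x _).trans (hD ⟨c, hc⟩)
    have hdev := (abs_dev_block_le q hd hyx ⟨c, hc⟩ j).trans (hD ⟨c, hc⟩)
    simp only at hdev
    rw [compressUnary_succ_sub (fun i => (q i).toMap) ⟨c, hc⟩, MapSeed.norm_sq_eq]
    set x' := x - j * (d * 2 ^ (c + 1)) with hx'
    set y' := y - j * (d * 2 ^ (c + 1)) with hy'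
    set V := blockPair (fun i => (q i).toMap) ⟨c, hc⟩ y' x' with hV
    have hpow : d * 2 ^ (c + 1) = d * 2 ^ c + d * 2 ^ c := by ring
    -- The halves of block `j` are the blocks `2 j` and `2 j + 1` of the level below.
    have e1 : ∀ z, z - j * (d * 2 ^ (c + 1)) = z - (2 * j) * (d * 2 ^ c) := fun z => by
      congr 1; rw [hpow]; ring
    have e2 : ∀ z, z - j * (d * 2 ^ (c + 1)) - d * 2 ^ c = z - (2 * j + 1) * (d * 2 ^ c) :=
      fun z => by rw [Nat.sub_sub]; congr 1; rw [hpow]; ring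
    have ih1 := ih (by omega) (2 * j)
    have ih2 := ih (by omega) (2 * j + 1)
    rw [← e1, ← e1, ← hx', ← hy'] at ih1
    rw [← e2, ← e2, ← hx', ← hy'] at ih2
    have hmin : ∀ z, (min z (d * 2 ^ (c + 1)) : ℕ)
        = min z (d * 2 ^ c) + min (z - d * 2 ^ c) (d * 2 ^ c) := fun z => by omega
    have hN : pairNormSq V
        = ‖compressUnary (fun i => (q i).toMap) c (by omega) x'
            - compressUnary (fun i => (q i).toMap) c (by omega) y'‖ ^ 2
          + ‖compressUnary (fun i => (q i).toMap) c (by omega) (x' - d * 2 ^ c)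
            - compressUnary (fun i => (q i).toMap) c (by omega) (y' - d * 2 ^ c)‖ ^ 2 := rfl
    have hN0 := pairNormSq_nonneg V
    rw [prod_range_succ, prod_range_succ, hmin, hmin]
    push_cast
    rw [abs_le] at hdev
    constructor
    · calc _ = (1 - D c) * ((∏ i ∈ range c, (1 - D i)) *
            ((min x' (d * 2 ^ c) : ℕ) - (min y' (d * 2 ^ c) : ℕ)) +
            (∏ i ∈ range c, (1 - D i)) *
            ((min (x' - d * 2 ^ c) (d * 2 ^ c) : ℕ) - (min (y' - d * 2 ^ c) (d * 2 ^ c) : ℕ))) := by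
            push_cast; ring
        _ ≤ (1 - D c) * pairNormSq V := by
            rw [hN]
            exact mul_le_mul_of_nonneg_left (add_le_add ih1.1 ih2.1) (by linarith [hD1 c])
        _ ≤ _ := mul_le_mul_of_nonneg_right (by linarith) hN0
    · calc _ ≤ (1 + D c) * pairNormSq V := mul_le_mul_of_nonneg_right (by linarith) hN0
        _ ≤ (1 + D c) * ((∏ i ∈ range c, (1 + D i)) *
            ((min x' (d * 2 ^ c) : ℕ) - (min y' (d * 2 ^ c) : ℕ)) +
            (∏ i ∈ range c, (1 + D i)) *
            ((min (x' - d * 2 ^ c) (d * 2 ^ c) : ℕ) - (min (y' - d * 2 ^ c) (d * 2 ^ c) : ℕ))) := by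
            rw [hN]
            exact mul_le_mul_of_nonneg_left (add_le_add ih1.2 ih2.2) (by linarith)
        _ = _ := by push_cast; ring

theorem one_sub_sum_le_prod (D : ℕ → ℝ) (h0 : ∀ i, 0 ≤ D i) (h1 : ∀ i, D i ≤ 1) (c : ℕ) :
    1 - ∑ i ∈ range c, D i ≤ ∏ i ∈ range c, (1 - D i) := by
  induction c with
  | zero => simp
  | succ c ih =>
    rw [sum_range_succ, prod_range_succ]
    have hp : ∏ i ∈ range c, (1 - D i) ≤ 1 :=
      prod_le_one (fun i _ => by linarith [h1 i]) fun i _ => by linarith [h0 i]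
    nlinarith [h0 c]

theorem prod_one_add_le (D : ℕ → ℝ) (h0 : ∀ i, 0 ≤ D i) (c : ℕ)
    (h : ∑ i ∈ range c, D i ≤ 1 / 2) :
    ∏ i ∈ range c, (1 + D i) ≤ 1 + 2 * ∑ i ∈ range c, D i := by
  have hS : 0 ≤ ∑ i ∈ range c, D i := sum_nonneg fun i _ => h0 i
  calc ∏ i ∈ range c, (1 + D i) ≤ ∏ i ∈ range c, Real.exp (D i) :=
        prod_le_prod (fun i _ => by linarith [h0 i]) fun i _ => by
          rw [add_comm]; exact Real.add_one_le_exp _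
    _ = Real.exp (∑ i ∈ range c, D i) := (Real.exp_sum _ _).symm
    _ ≤ 1 + 2 * ∑ i ∈ range c, D i := by
        have := Real.abs_exp_sub_one_le (x := ∑ i ∈ range c, D i) (by
          rw [abs_of_nonneg hS]; linarith)
        rw [abs_of_nonneg hS] at this
        linarith [(abs_le.1 this).2]

/-- If the deviations sum up to `η ≤ 1 / 2`, the distances are distorted by `1 ± 4 η`. -/
theorem approxEq_of_sum_absDev_le (hd : 0 < d) {y x : ℕ} (hyx : y ≤ x) (hx : x ≤ d * 2 ^ k)
    {η : ℝ} (hη : η ≤ 1 / 2) (h : ∑ p, absDev q y x p ≤ η) :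
    ApproxEq (4 * η) |(x : ℝ) - y|
      (‖project (fun i => (q i).toMap) k le_rfl x - project (fun i => (q i).toMap) k le_rfl y‖ ^ 2) := by
  -- The value zero outside the levels makes the bounds required for all natural `i` hold.
  set D : ℕ → ℝ := fun i => if h : i < k then ∑ m, absDev q y x (⟨i, h⟩, m) else 0 with hDdef
  have hsum : ∑ i ∈ range k, D i ≤ η := by
    rw [Finset.sum_range]
    simp only [hDdef, Fin.is_lt, dite_true, Fin.eta]
    rw [← univ_product_univ, sum_product] at h
    exact h
  have h0 : ∀ i, 0 ≤ D i := by
    intro i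
    simp only [hDdef]
    split_ifs
    · exact sum_nonneg fun m _ => absDev_nonneg q y x _
    · exact le_rfl
  have h1 : ∀ i, D i ≤ 1 := by
    intro i
    by_cases hi : i < k
    · have := single_le_sum (f := D) (fun i _ => h0 i) (mem_range.2 hi)
      linarith
    · simp [hDdef, hi]
  have hη0 : 0 ≤ η := (sum_nonneg fun i _ => h0 i).trans hsum
  have hb := norm_compressUnary_sub_bounds q hd hyx D (fun i => by simp [hDdef]) h1 k le_rfl 0
  simp only [zero_mul, Nat.sub_zero, min_eq_left hx, min_eq_left (hyx.trans hx)] at hb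
  rw [project_eq _ _ _ _ hx, project_eq _ _ _ _ (hyx.trans hx)]
  set B := ‖compressUnary (fun i => (q i).toMap) k le_rfl x
    - compressUnary (fun i => (q i).toMap) k le_rfl y‖ ^ 2
  have hl : (0 : ℝ) ≤ (x : ℝ) - y := by
    rw [sub_nonneg]; exact_mod_cast hyx
  rw [abs_of_nonneg hl]
  set l := (x : ℝ) - y
  have hlow : (1 - η) * l ≤ B :=
    (mul_le_mul_of_nonneg_right (by linarith [one_sub_sum_le_prod D h0 h1 k]) hl).trans hb.1
  have hup : B ≤ (1 + 2 * η) * l :=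
    hb.2.trans (mul_le_mul_of_nonneg_right (by linarith [prod_one_add_le D h0 k (hsum.trans hη)]) hl)
  have hηl : 0 ≤ η * l := mul_nonneg hη0 hl
  have hB : 0 ≤ B := by positivity
  constructor
  -- The estimates `(1 - η) l ≤ B ≤ (1 + 2 η) l` are inverted through `(1 - 4 η) (1 + 2 η) ≤ 1` and
  -- `(1 + 4 η) (1 - η) ≥ 1`, the latter because `η ≤ 1 / 2`. For `1 - 4 η ≤ 0` the lower bound is
  -- trivial.
  · by_cases h4 : 1 - 4 * η ≤ 0
    · nlinarith
    · have := mul_le_mul_of_nonneg_left hup (not_le.1 h4).le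
      nlinarith
  · have := mul_le_mul_of_nonneg_left hlow (by linarith : 0 ≤ 1 + 4 * η)
    nlinarith

end Distortion

/-! ### Concentration -/

/-- A product of uniform laws on finite sets is uniform, so probabilities become finite averages. -/
theorem mapsLaw_eq (k d s : ℕ) : mapsLaw k d s = uniformOn Set.univ := by
  have h1 : mapLaw d s = uniformOn Set.univ := by
    have h2 : (Measure.pi fun _ : Fin d => columnLaw d s) = uniformOn Set.univ := by
      simp only [columnLaw]
      rw [← uniformOn_pi, Set.pi_univ]
    rw [mapLaw, h2, ← uniformOn_pi, Set.pi_univ]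
  rw [mapsLaw, h1, ← uniformOn_pi, Set.pi_univ]

theorem isProbabilityMeasure_mapsLaw {k d s : ℕ} (h : s ≤ d) :
    IsProbabilityMeasure (mapsLaw k d s) := by
  have := nonempty_columnSeed h
  rw [mapsLaw_eq]
  infer_instance

open Classical in
theorem mapsLaw_real_eq {k d s : ℕ} (S : Set (Fin k → MapSeed d s)) :
    (mapsLaw k d s).real S = 𝔼 q : Fin k → MapSeed d s, if q ∈ S then (1 : ℝ) else 0 := by
  rw [mapsLaw_eq, Measure.real, uniformOn_univ, Fintype.expect_eq_sum_div_card, sum_boole,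
    ENNReal.toReal_div]
  have : S = ((univ.filter fun q => q ∈ S : Finset _) : Set (Fin k → MapSeed d s)) := by simp
  conv_lhs => rw [this]
  rw [Measure.count_apply_finset]
  simp

/-- Markov's inequality for exponential moments. -/
theorem mapsLaw_real_lt_le {k d s : ℕ} (X : (Fin k → MapSeed d s) → ℝ) (L t : ℝ) (hL : 0 ≤ L) :
    (mapsLaw k d s).real {q | t < X q} ≤ Real.exp (-(L * t)) * 𝔼 q, Real.exp (L * X q) := by
  classical
  rw [mapsLaw_real_eq, mul_expect]
  refine expect_le_expect fun q _ => ?_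
  rw [← Real.exp_add]
  split_ifs with h
  · refine Real.one_le_exp ?_
    have := mul_le_mul_of_nonneg_left (le_of_lt h) hL
    linarith
  · positivity

/-- Resampling the map of the level leaves its input fixed, so the bound for a single map applies.
The factor two comes from `exp |z| ≤ exp z + exp (-z)`. -/
theorem expect_exp_absDev_le {k d s : ℕ} (hsd : s ≤ d) (hs : 0 < s) (y x : ℕ) (p : Fin k × Fin 3)
    {L : ℝ} (hL0 : 0 ≤ L) (hL : L ≤ s / 8) :
    𝔼 q : Fin k → MapSeed d s, Real.exp (L * absDev q y x p)
      ≤ 2 * Real.exp (8 * L ^ 2 / d) := by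
  have : Nonempty (ColumnSeed d s) := nonempty_columnSeed hsd
  have hLabs : |L| ≤ s / 8 := by rwa [abs_of_nonneg hL0]
  rw [← expect_expect_update p.1]
  refine expect_le univ_nonempty fun q _ => ?_
  set V := blockPair (fun i => (q i).toMap) p.1 (devBlock (d := d) y x p.1 p.2).1
    (devBlock (d := d) y x p.1 p.2).2 with hV
  have hdev : ∀ t : MapSeed d s, absDev (Function.update q p.1 t) y x p = |t.dev V| := by
    intro t
    rw [absDev, Function.update_self, hV]
    congr 2
    refine blockPair_congr _ _ _ (fun j hj => ?_) _ _
    simp only [Function.update_of_ne (Fin.ne_of_lt hj)]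
  simp only [hdev]
  calc 𝔼 t : MapSeed d s, Real.exp (L * |t.dev V|)
      ≤ 𝔼 t : MapSeed d s, (Real.exp (L * t.dev V) + Real.exp (-L * t.dev V)) := by
        refine expect_le_expect fun t _ => ?_
        rcases abs_cases (t.dev V) with ⟨h, -⟩ | ⟨h, -⟩ <;> rw [h]
        · linarith [Real.exp_pos (-L * t.dev V)]
        · rw [mul_neg, ← neg_mul]
          linarith [Real.exp_pos (L * t.dev V)]
    _ ≤ Real.exp (8 * L ^ 2 / d) + Real.exp (8 * (-L) ^ 2 / d) := by
        rw [expect_add_distrib]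
        exact add_le_add (MapSeed.expect_exp_dev_le hsd hs V hLabs)
          (MapSeed.expect_exp_dev_le hsd hs V (by rwa [abs_neg]))
    _ = _ := by rw [neg_sq]; ring

/-- Markov's inequality for the mean of the `3 k` deviations. Convexity replaces both independence
between levels and a union bound, so the right side does not depend on `k`. -/
theorem mapsLaw_sum_absDev_le {k d s : ℕ} (hk : 0 < k) (hsd : s ≤ d) (hs : 0 < s) (y x : ℕ)
    {L t : ℝ} (hL0 : 0 ≤ L) (hL : L ≤ s / 8) :
    (mapsLaw k d s).real {q | 3 * k * t < ∑ p, absDev q y x p}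
      ≤ 2 * Real.exp (8 * L ^ 2 / d - L * t) := by
  have : Nonempty (ColumnSeed d s) := nonempty_columnSeed hsd
  have hk' : (0 : ℝ) < 3 * k := by positivity
  have hset : {q : Fin k → MapSeed d s | 3 * k * t < ∑ p, absDev q y x p}
      = {q | t < ∑ p, (1 / (3 * k : ℝ)) * absDev q y x p} := by
    ext q
    simp only [Set.mem_ofPred_eq]
    rw [← mul_sum, one_div, inv_mul_eq_div, lt_div_iff₀ hk', mul_comm]
  rw [hset]
  refine (mapsLaw_real_lt_le _ L t hL0).trans ?_
  have h := expect_exp_sum_le (Ω := Fin k → MapSeed d s) univ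
    (fun _ : Fin k × Fin 3 => 1 / (3 * k : ℝ)) (fun p q => L * absDev q y x p)
    (fun _ _ => by positivity) (by simp; field_simp)
    (fun p _ _ => expect_exp_absDev_le hsd hs y x p hL0 hL)
  have h2 : ∀ q : Fin k → MapSeed d s, L * ∑ p, (1 / (3 * k : ℝ)) * absDev q y x p
      = ∑ p, (1 / (3 * k : ℝ)) * (L * absDev q y x p) := fun q => by
    rw [mul_sum]; exact sum_congr rfl fun p _ => by ring
  simp only [h2]
  calc _ ≤ Real.exp (-(L * t)) * (2 * Real.exp (8 * L ^ 2 / d)) := by gcongr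
    _ = _ := by rw [sub_eq_add_neg, Real.exp_add]; ring

/-- The constant in the lower bound for the dimension. -/
def dimConst (a κ : ℝ) : ℝ := 288 * (a + 2) ^ 2 + 48 * (a + 2) / κ

theorem dimConst_pos {a κ : ℝ} (ha : 0 < a) (hκ : 0 < κ) : 0 < dimConst a κ := by
  unfold dimConst; positivity

theorem mapsLaw_sum_absDev_le_rpow {k n d s : ℕ} {a κ ε : ℝ} (ha : 0 < a) (hκ : 0 < κ)
    (hn : 2 ≤ n) (hε : 0 < ε) (hd : dimConst a κ * Real.log n / ε ^ 2 ≤ d)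
    (hs : κ * (d * ε) ≤ s) (hsd : s ≤ d) (y x : ℕ) :
    (mapsLaw k d s).real {q | ε * k / 2 < ∑ p, absDev q y x p} ≤ (n : ℝ) ^ (-a) := by
  have hn' : (2 : ℝ) ≤ n := by exact_mod_cast hn
  have hlog : 0 < Real.log n := Real.log_pos (by linarith)
  have hd0 : (0 : ℝ) < d := lt_of_lt_of_le (by have := dimConst_pos ha hκ; positivity) hd
  have hs0 : 0 < s := by
    have : (0 : ℝ) < s := lt_of_lt_of_le (by positivity) hs
    exact_mod_cast this
  -- Without levels there is no mean to take; the sum of deviations is empty and the event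
  -- impossible.
  rcases Nat.eq_zero_or_pos k with rfl | hk
  · have : {q : Fin 0 → MapSeed d s | ε * ((0 : ℕ) : ℝ) / 2 < ∑ p, absDev q y x p} = ∅ := by
      ext q; simp
    rw [this]
    simp only [measureReal_empty]
    positivity
  -- With threshold `ε / 6` for the mean this makes `L * t = (a + 2) * log n`. The two summands of
  -- `dimConst` are what `8 L² / d ≤ log n` and `L ≤ s / 8` require, as `8 * 6² = 288` and `8 * 6 =
  -- 48`.
  set L := 6 * (a + 2) * Real.log n / ε with hL
  have hL0 : 0 ≤ L := by positivity
  have hd1 : 288 * (a + 2) ^ 2 * Real.log n ≤ d * ε ^ 2 := by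
    rw [div_le_iff₀ (by positivity)] at hd
    refine le_trans ?_ hd
    gcongr
    unfold dimConst
    linarith [show 0 ≤ 48 * (a + 2) / κ by positivity]
  have hd2 : 48 * (a + 2) / κ * Real.log n ≤ d * ε ^ 2 := by
    rw [div_le_iff₀ (by positivity)] at hd
    refine le_trans ?_ hd
    gcongr
    unfold dimConst
    linarith [show 0 ≤ 288 * (a + 2) ^ 2 by positivity]
  have hLs : L ≤ s / 8 := by
    rw [le_div_iff₀ (by norm_num)]
    refine le_trans ?_ hs
    rw [hL, div_mul_eq_mul_div, div_le_iff₀ hε]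
    rw [div_mul_eq_mul_div, div_le_iff₀ hκ] at hd2
    nlinarith
  have hLd : 8 * L ^ 2 / d ≤ Real.log n := by
    rw [div_le_iff₀ hd0, hL, div_pow, mul_div_assoc', div_le_iff₀ (by positivity)]
    have := mul_le_mul_of_nonneg_left hd1 hlog.le
    nlinarith
  have h := mapsLaw_sum_absDev_le hk hsd hs0 y x (t := ε / 6) hL0 hLs
  have he : 3 * (k : ℝ) * (ε / 6) = ε * k / 2 := by ring
  rw [he] at h
  refine h.trans ?_
  have hLt : L * (ε / 6) = (a + 2) * Real.log n := by rw [hL]; field_simp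
  rw [hLt]
  -- Of the exponent `a + 2`, one unit pays for `8 L² / d` and one for the factor `2 ≤ n`.
  calc 2 * Real.exp (8 * L ^ 2 / d - (a + 2) * Real.log n)
      ≤ n * Real.exp (Real.log n - (a + 2) * Real.log n) := by gcongr
    _ = Real.exp (Real.log n) * Real.exp (Real.log n - (a + 2) * Real.log n) := by
        rw [Real.exp_log (by linarith)]
    _ = (n : ℝ) ^ (-a) := by
        rw [← Real.exp_add, Real.rpow_def_of_pos (by linarith)]
        ring_nf

/-! ### Distortion of the embedding -/

theorem le_mul_two_pow_levels {d u : ℕ} (hd : 0 < d) : u ≤ d * 2 ^ levels d u := by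
  have h1 : u ⌈/⌉ d ≤ 2 ^ levels d u := Nat.le_pow_clog (by norm_num) _
  have := (ceilDiv_le_iff_le_mul hd).1 h1
  rwa [mul_comm] at this ⊢

theorem levels_le_log {d u : ℕ} (hd : 0 < d) (hu : 2 ≤ u) : (levels d u : ℝ) ≤ 3 * Real.log u := by
  have hle : u ⌈/⌉ d ≤ u := by
    rw [ceilDiv_le_iff_le_mul hd]; exact Nat.le_mul_of_pos_left u hd
  have hlev : levels d u ≤ Nat.clog 2 u := Nat.clog_mono_right 2 hle
  have hpow : 2 ^ (Nat.clog 2 u - 1) ≤ u := (Nat.pow_pred_clog_lt_self (by norm_num) (by omega)).le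
  have hu' : (2 : ℝ) ≤ u := by exact_mod_cast hu
  -- The constant three: the number of levels is at most `log₂ u + 1 ≤ 2 log₂ u`, and `2 / log 2 ≤
  -- 3`.
  have hlog2 : (2 / 3 : ℝ) ≤ Real.log 2 := by linarith [Real.log_two_gt_d9]
  have h2u : Real.log 2 ≤ Real.log u := Real.log_le_log (by norm_num) hu'
  have h1 : ((Nat.clog 2 u - 1 : ℕ) : ℝ) * Real.log 2 ≤ Real.log u := by
    rw [← Real.log_pow]
    exact Real.log_le_log (by positivity) (by exact_mod_cast hpow)
  have h2 : ((Nat.clog 2 u : ℕ) : ℝ) ≤ ((Nat.clog 2 u - 1 : ℕ) : ℝ) + 1 := by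
    exact_mod_cast (by omega : Nat.clog 2 u ≤ Nat.clog 2 u - 1 + 1)
  have h3 : (levels d u : ℝ) ≤ Nat.clog 2 u := by exact_mod_cast hlev
  have h4 : (0 : ℝ) ≤ ((Nat.clog 2 u - 1 : ℕ) : ℝ) := Nat.cast_nonneg _
  nlinarith

theorem ApproxEq.mono {η η' A B : ℝ} (h : ApproxEq η A B) (hη : η ≤ η') (hB : 0 ≤ B) :
    ApproxEq η' A B :=
  ⟨(mul_le_mul_of_nonneg_right (by linarith) hB).trans h.1,
    h.2.trans (mul_le_mul_of_nonneg_right (by linarith) hB)⟩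

theorem approxEq_psi {d s u : ℕ} (hd : 0 < d) (hu : 2 ≤ u) {ε : ℝ} (hε : 0 < ε)
    (hεk : ε * levels d u ≤ 1) (q : Fin (levels d u) → MapSeed d s) {y x : ℕ} (hyx : y ≤ x)
    (hx : x ≤ u) (h : ∑ p, absDev q y x p ≤ ε * levels d u / 2) :
    ApproxEq (6 * (ε * Real.log u)) |(x : ℝ) - y| (‖psi u q x - psi u q y‖ ^ 2) := by
  -- With `η = ε k / 2 ≤ 1 / 2` the distortion is `4 η = 2 ε k`, and `k ≤ 3 log u` yields the
  -- constant six.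
  refine (approxEq_of_sum_absDev_le q hd hyx (hx.trans (le_mul_two_pow_levels hd))
    (by linarith) h).mono ?_ (by positivity)
  have := mul_le_mul_of_nonneg_left (levels_le_log hd hu) hε.le
  linarith

theorem mapsLaw_not_approxEq_psi_le {n d s u : ℕ} {a κ ε : ℝ} (ha : 0 < a) (hκ : 0 < κ)
    (hn : 2 ≤ n) (hu : 2 ≤ u) (hε : 0 < ε) (hd : dimConst a κ * Real.log n / ε ^ 2 ≤ d)
    (hs : κ * (d * ε) ≤ s) (hsd : s ≤ d) (hεk : ε * levels d u ≤ 1) {x y : ℕ} (hx : x ≤ u)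
    (hy : y ≤ u) :
    (mapsLaw (levels d u) d s).real {q | ¬ ApproxEq (6 * (ε * Real.log u)) |(x : ℝ) - y|
      (‖psi u q x - psi u q y‖ ^ 2)} ≤ (n : ℝ) ^ (-a) := by
  have := isProbabilityMeasure_mapsLaw (k := levels d u) hsd
  have hn' : (2 : ℝ) ≤ n := by exact_mod_cast hn
  have hlog : 0 < Real.log n := Real.log_pos (by linarith)
  have hd0 : 0 < d := by
    have : (0 : ℝ) < d := lt_of_lt_of_le (by have := dimConst_pos ha hκ; positivity) hd
    exact_mod_cast this
  rcases le_total y x with h | h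
  · refine le_trans (measureReal_mono fun q hq => ?_)
      (mapsLaw_sum_absDev_le_rpow ha hκ hn hε hd hs hsd y x)
    by_contra hc
    exact hq (approxEq_psi hd0 hu hε hεk q h hx (not_lt.1 hc))
  · refine le_trans (measureReal_mono fun q hq => ?_)
      (mapsLaw_sum_absDev_le_rpow ha hκ hn hε hd hs hsd x y)
    by_contra hc
    refine hq ?_
    rw [abs_sub_comm, norm_sub_rev]
    exact approxEq_psi hd0 hu hε hεk q h hy (not_lt.1 hc)

theorem le_mapsLaw_of_not {k d s : ℕ} (hsd : s ≤ d) {P : (Fin k → MapSeed d s) → Prop} {δ : ℝ}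
    (h : (mapsLaw k d s).real {q | ¬ P q} ≤ δ) : 1 - δ ≤ (mapsLaw k d s).real {q | P q} := by
  have := isProbabilityMeasure_mapsLaw (k := k) hsd
  have h1 : (mapsLaw k d s).real {q | P q}ᶜ = 1 - (mapsLaw k d s).real {q | P q} :=
    probReal_compl_eq_one_sub (Set.toFinite _).measurableSet
  have h2 : {q | P q}ᶜ = {q : Fin k → MapSeed d s | ¬ P q} := rfl
  rw [h2] at h1
  linarith

theorem le_mapsLaw_forall_approxEq_psi {n d s u : ℕ} {a b κ ε : ℝ} (ha : 0 < a) (hb : 0 < b)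
    (hκ : 0 < κ) (hn : 2 ≤ n) (hu : 2 ≤ u) (hε : 0 < ε)
    (hd : dimConst (a + 2 * b + 2) κ * Real.log n / ε ^ 2 ≤ d)
    (hs : κ * (d * ε) ≤ s) (hsd : s ≤ d) (hεk : ε * levels d u ≤ 1) (hub : (u : ℝ) ≤ (n : ℝ) ^ b) :
    1 - (n : ℝ) ^ (-a) ≤ (mapsLaw (levels d u) d s).real {q | ∀ x y : ℕ, x ≤ u → y ≤ u →
      ApproxEq (6 * (ε * Real.log u)) |(x : ℝ) - y| (‖psi u q x - psi u q y‖ ^ 2)} := by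
  have := isProbabilityMeasure_mapsLaw (k := levels d u) hsd
  have hn' : (2 : ℝ) ≤ n := by exact_mod_cast hn
  have hn0 : (0 : ℝ) < n := by linarith
  refine le_mapsLaw_of_not hsd ?_
  have hsub : {q : Fin (levels d u) → MapSeed d s | ¬ ∀ x y : ℕ, x ≤ u → y ≤ u →
      ApproxEq (6 * (ε * Real.log u)) |(x : ℝ) - y| (‖psi u q x - psi u q y‖ ^ 2)}
      ⊆ ⋃ p ∈ range (u + 1) ×ˢ range (u + 1), {q | ¬ ApproxEq (6 * (ε * Real.log u))
        |(p.1 : ℝ) - p.2| (‖psi u q p.1 - psi u q p.2‖ ^ 2)} := by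
    intro q hq
    simp only [Set.mem_ofPred_eq, not_forall] at hq
    obtain ⟨x, y, hx, hy, hxy⟩ := hq
    simp only [Set.mem_iUnion]
    exact ⟨(x, y), by simp; omega, hxy⟩
  refine (measureReal_mono hsub (measure_ne_top _ _)).trans ((measureReal_biUnion_finset_le _ _).trans ?_)
  calc _ ≤ ∑ p ∈ range (u + 1) ×ˢ range (u + 1), (n : ℝ) ^ (-(a + 2 * b + 2)) := by
        refine sum_le_sum fun p hp => ?_
        simp only [mem_product, mem_range] at hp
        exact mapsLaw_not_approxEq_psi_le (by positivity) hκ hn hu hε hd hs hsd hεk (by omega)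
          (by omega)
    _ = ((u : ℝ) + 1) ^ 2 * (n : ℝ) ^ (-(a + 2 * b + 2)) := by
        rw [sum_const, card_product, card_range, nsmul_eq_mul]; push_cast; ring
    -- By `u + 1 ≤ 2 u ≤ n ^ b * n` the union bound costs `n ^ (2 b + 2)`, which the enlarged
    -- exponent absorbs.
    _ ≤ ((n : ℝ) ^ b * n) ^ 2 * (n : ℝ) ^ (-(a + 2 * b + 2)) := by
        gcongr
        have : (2 : ℝ) ≤ u := by exact_mod_cast hu
        nlinarith
    _ = (n : ℝ) ^ (-a) := by
        have h1 : ((n : ℝ) ^ b * n) ^ 2 = (n : ℝ) ^ (2 * b + 2) := by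
          rw [mul_pow, ← Real.rpow_natCast, ← Real.rpow_natCast, ← Real.rpow_mul hn0.le,
            ← Real.rpow_add hn0]
          congr 1; push_cast; ring
        rw [h1, ← Real.rpow_add hn0]
        congr 1; ring

theorem le_mapsLaw_approxEq_psi {n d s u : ℕ} {a b κ ε : ℝ} (ha : 0 < a) (hb : 0 < b)
    (hκ : 0 < κ) (hn : 2 ≤ n) (hu : 2 ≤ u) (hε : 0 < ε)
    (hd : dimConst (a + 2 * b + 2) κ * Real.log n / ε ^ 2 ≤ d)
    (hs : κ * (d * ε) ≤ s) (hsd : s ≤ d) (hεk : ε * levels d u ≤ 1) {x y : ℕ} (hx : x ≤ u)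
    (hy : y ≤ u) :
    1 - (n : ℝ) ^ (-a) ≤ (mapsLaw (levels d u) d s).real {q |
      ApproxEq (6 * (ε * Real.log u)) |(x : ℝ) - y| (‖psi u q x - psi u q y‖ ^ 2)} := by
  refine le_mapsLaw_of_not hsd
    ((mapsLaw_not_approxEq_psi_le (by positivity) hκ hn hu hε hd hs hsd hεk hx hy).trans ?_)
  have hn' : (2 : ℝ) ≤ n := by exact_mod_cast hn
  exact Real.rpow_le_rpow_of_exponent_le (by linarith) (by linarith)

/-! ### Total correctness with a time bound -/

/-- Started in `σ`, the program `p` halts within `T` steps in a state that satisfies `Q`. -/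
def Exec (p : Program) (σ : State) (T : ℕ) (Q : State → Prop) : Prop :=
  ∃ t σ', Runs p σ t σ' ∧ t ≤ T ∧ Q σ'

theorem Exec.mono {p : Program} {σ : State} {T T' : ℕ} {Q Q' : State → Prop} (h : Exec p σ T Q)
    (hT : T ≤ T') (hQ : ∀ σ', Q σ' → Q' σ') : Exec p σ T' Q' := by
  obtain ⟨t, σ', hr, ht, hq⟩ := h
  exact ⟨t, σ', hr, ht.trans hT, hQ σ' hq⟩

theorem Exec.seq {p q : Program} {σ : State} {T T' : ℕ} {Q Q' : State → Prop} (h : Exec p σ T Q)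
    (h' : ∀ σ', Q σ' → Exec q σ' T' Q') : Exec (.seq p q) σ (T + T') Q' := by
  obtain ⟨t, σ', hr, ht, hq⟩ := h
  obtain ⟨t', σ'', hr', ht', hq'⟩ := h' σ' hq
  exact ⟨t + t', σ'', .seq hr hr', by omega, hq'⟩

theorem Exec.ifLt {a b : ℕ} {p q : Program} {σ : State} {T : ℕ} {Q : State → Prop}
    (h : σ.ireg a < σ.ireg b → Exec p σ T Q) (h' : ¬ σ.ireg a < σ.ireg b → Exec q σ T Q) :
    Exec (.ifLt a b p q) σ (T + 1) Q := by
  by_cases hc : σ.ireg a < σ.ireg b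
  · obtain ⟨t, σ', hr, ht, hq⟩ := h hc
    exact ⟨t + 1, σ', .ifTrue hc hr, by omega, hq⟩
  · obtain ⟨t, σ', hr, ht, hq⟩ := h' hc
    exact ⟨t + 1, σ', .ifFalse hc hr, by omega, hq⟩

/-- A loop that is executed exactly `N` times. -/
theorem Exec.whileLt {a b : ℕ} {p : Program} {σ : State} {N T : ℕ} (I : ℕ → State → Prop)
    (h0 : I 0 σ)
    (hstep : ∀ i < N, ∀ σ', I i σ' → σ'.ireg a < σ'.ireg b ∧ Exec p σ' T (I (i + 1)))
    (hend : ∀ σ', I N σ' → ¬ σ'.ireg a < σ'.ireg b) :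
    Exec (.whileLt a b p) σ (N * (T + 1) + 1) (I N) := by
  have key : ∀ m i, i + m = N → ∀ σ', I i σ' →
      Exec (.whileLt a b p) σ' (m * (T + 1) + 1) (I N) := by
    intro m
    induction m with
    | zero =>
      intro i hi σ' hI
      rw [Nat.add_zero] at hi
      subst hi
      exact ⟨1, σ', .whileFalse (hend σ' hI), by omega, hI⟩
    | succ m ih =>
      intro i hi σ' hI
      obtain ⟨hlt, t, σ'', hr, ht, hI'⟩ := hstep i (by omega) σ' hI
      obtain ⟨t', σ₃, hr', ht', hQ⟩ := ih (i + 1) (by omega) σ'' hI'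
      exact ⟨t + t' + 1, σ₃, .whileTrue hlt hr hr', by rw [Nat.succ_mul]; omega, hQ⟩
  exact key N 0 (by omega) σ h0

/-- Straight-line code. -/
def line : Instr → List Instr → Program
  | i, [] => .instr i
  | i, j :: l => .seq (.instr i) (line j l)

theorem Exec.line {i : Instr} {l : List Instr} {σ : State} {Q : State → Prop}
    (h : Q (l.foldl Instr.exec (i.exec σ))) : Exec (line i l) σ (l.length + 1) Q := by
  induction l generalizing i σ with
  | nil => exact ⟨1, _, .instr i σ, le_rfl, h⟩
  | cons j l ih =>
    obtain ⟨t, σ', hr, ht, hq⟩ := ih (i := j) (σ := i.exec σ) h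
    exact ⟨1 + t, σ', .seq (.instr i σ) hr, by simp only [List.length_cons]; omega, hq⟩

/-- `σ'` agrees with `σ` in the integer registers up to `n`, in the integer memory, and in the
real memory below the address `D`. -/
structure Frame (n D : ℕ) (σ σ' : State) : Prop where
  ireg : ∀ t ≤ n, σ'.ireg t = σ.ireg t
  imem : σ'.imem = σ.imem
  rmem : ∀ a < D, σ'.rmem a = σ.rmem a

theorem Frame.trans {n D : ℕ} {σ₁ σ₂ σ₃ : State} (h : Frame n D σ₁ σ₂) (h' : Frame n D σ₂ σ₃) :
    Frame n D σ₁ σ₃ :=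
  ⟨fun t ht => (h'.ireg t ht).trans (h.ireg t ht), h'.imem.trans h.imem,
    fun a ha => (h'.rmem a ha).trans (h.rmem a ha)⟩

theorem Frame.mono {n n' D D' : ℕ} {σ₁ σ₂ : State} (h : Frame n D σ₁ σ₂) (hn : n' ≤ n)
    (hD : D' ≤ D) : Frame n' D' σ₁ σ₂ :=
  ⟨fun t ht => h.ireg t (ht.trans hn), h.imem, fun a ha => h.rmem a (ha.trans_le hD)⟩

/-! ### Multiplication of a vector by a sparse matrix

Integer registers: `0` holds the dimension, `1` the sparsity, `5` the constant one, `20` the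
address of the vector, `21` the address of the result, `22` the address of the matrix. -/

/-- Adds a multiple of one column of the matrix to the result. -/
def addColumn : Program :=
  .seq (line (.iconst 24 0) [])
    (.whileLt 24 1 (line (.iload 25 22)
      [.rload 1 22, .iadd 26 21 25, .rload 2 26, .rmul 1 1 0, .radd 2 2 1, .rstore 26 2,
        .iadd 22 22 5, .iadd 24 24 5]))

/-- The matrix lies below the result, so the stores never touch entries that are still to be read.
Register `22` ends just behind the column, ready for the next one. -/
theorem exec_addColumn (σ : State) (h5 : σ.ireg 5 = 1)
    (hptr : σ.ireg 22 + σ.ireg 1 ≤ σ.ireg 21) :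
    Exec addColumn σ (10 * σ.ireg 1 + 2) fun σ' =>
      Frame 21 (σ.ireg 21) σ σ' ∧ σ'.ireg 22 = σ.ireg 22 + σ.ireg 1 ∧ σ'.ireg 23 = σ.ireg 23 ∧
      ∀ i, σ'.rmem (σ.ireg 21 + i) = σ.rmem (σ.ireg 21 + i) +
        (∑ j ∈ range (σ.ireg 1), if σ.imem (σ.ireg 22 + j) = i then σ.rmem (σ.ireg 22 + j) else 0)
          * σ.rreg 0 := by
  let I : ℕ → State → Prop := fun J σ' =>
    Frame 21 (σ.ireg 21) σ σ' ∧ σ'.ireg 22 = σ.ireg 22 + J ∧ σ'.ireg 23 = σ.ireg 23 ∧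
    σ'.ireg 24 = J ∧ σ'.rreg 0 = σ.rreg 0 ∧
      ∀ i, σ'.rmem (σ.ireg 21 + i) = σ.rmem (σ.ireg 21 + i) +
        (∑ j ∈ range J, if σ.imem (σ.ireg 22 + j) = i then σ.rmem (σ.ireg 22 + j) else 0)
          * σ.rreg 0
  refine Exec.mono (Exec.seq (Exec.line (Q := I 0) ?_) fun σ₁ h₁ =>
    Exec.whileLt (N := σ.ireg 1) (T := 9) I h₁ ?_ ?_) ?_ ?_
  · refine ⟨⟨fun t ht => ?_, rfl, fun _ _ => rfl⟩, ?_, ?_, ?_, ?_, ?_⟩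
    · have : t ≠ 24 := by omega
      simp [Instr.exec, this]
    all_goals simp [Instr.exec]
  · rintro J hJ σ' ⟨hF, h22, h23, h24, hr0, hm⟩
    have e1 := hF.ireg 1 (by norm_num)
    have e5 := hF.ireg 5 (by norm_num)
    have e21 := hF.ireg 21 (by norm_num)
    refine ⟨by rw [h24, e1]; exact hJ, Exec.line ?_⟩
    have hval : σ'.rmem (σ.ireg 22 + J) = σ.rmem (σ.ireg 22 + J) := hF.rmem _ (by omega)
    refine ⟨⟨fun t ht => ?_, ?_, fun a ha => ?_⟩, ?_, ?_, ?_, ?_, fun i => ?_⟩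
    · have h1 : t ≠ 22 := by omega
      have h2 : t ≠ 24 := by omega
      have h3 : t ≠ 25 := by omega
      have h4 : t ≠ 26 := by omega
      simpa [Instr.exec, h1, h2, h3, h4] using hF.ireg t ht
    · simpa [Instr.exec] using hF.imem
    · have hne : a ≠ σ.ireg 21 + σ.imem (σ.ireg 22 + J) := by omega
      simpa [Instr.exec, e21, h22, hF.imem, hne] using hF.rmem a ha
    · simp [Instr.exec, e5, h5, h22]; omega
    · simp [Instr.exec, h23]
    · simp [Instr.exec, e5, h5, h24]
    · simp [Instr.exec, hr0]
    · rw [sum_range_succ]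
      by_cases hi : σ.imem (σ.ireg 22 + J) = i
      · subst hi
        simp [Instr.exec, e21, h22, hF.imem, hm, hval, hr0]
        ring
      · have hne : i ≠ σ.imem (σ.ireg 22 + J) := fun h => hi h.symm
        simp [Instr.exec, e21, h22, hF.imem, hm, hne, hi]
  · rintro σ' ⟨hF, -, -, h24, -, -⟩
    rw [h24, hF.ireg 1 (by norm_num)]; exact lt_irrefl _
  · simp; omega
  · rintro σ' ⟨hF, h22, h23, h24, hr0, hm⟩
    exact ⟨hF, h22, h23, hm⟩

/-- The entry at row `i` and column `c` of the sparse `s`-column matrix stored at `ptr`. -/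
def storedEntry (σ : State) (s ptr i c : ℕ) : ℝ :=
  ∑ j ∈ range s, if σ.imem (ptr + c * s + j) = i then σ.rmem (ptr + c * s + j) else 0

/-- Adds the product of the matrix and the vector to the result. -/
def matVec : Program :=
  .seq (line (.iconst 23 0) [])
    (.whileLt 23 0 (.seq (line (.iadd 27 20 23) [.rload 0 27])
      (.seq addColumn (line (.iadd 23 23 5) []))))

/-- The final value of register `22` is part of the conclusion because the second matrix of a map
starts there. -/
theorem exec_matVec (σ : State) (h5 : σ.ireg 5 = 1)
    (hptr : σ.ireg 22 + σ.ireg 0 * σ.ireg 1 ≤ σ.ireg 21)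
    (hsrc : σ.ireg 20 + σ.ireg 0 ≤ σ.ireg 21) :
    Exec matVec σ (σ.ireg 0 * (10 * σ.ireg 1 + 6) + 2) fun σ' =>
      Frame 21 (σ.ireg 21) σ σ' ∧ σ'.ireg 22 = σ.ireg 22 + σ.ireg 0 * σ.ireg 1 ∧
      ∀ i, σ'.rmem (σ.ireg 21 + i) = σ.rmem (σ.ireg 21 + i) +
        ∑ c ∈ range (σ.ireg 0), storedEntry σ (σ.ireg 1) (σ.ireg 22) i c
          * σ.rmem (σ.ireg 20 + c) := by
  let I : ℕ → State → Prop := fun C σ' =>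
    Frame 21 (σ.ireg 21) σ σ' ∧ σ'.ireg 22 = σ.ireg 22 + C * σ.ireg 1 ∧ σ'.ireg 23 = C ∧
      ∀ i, σ'.rmem (σ.ireg 21 + i) = σ.rmem (σ.ireg 21 + i) +
        ∑ c ∈ range C, storedEntry σ (σ.ireg 1) (σ.ireg 22) i c * σ.rmem (σ.ireg 20 + c)
  refine Exec.mono (Exec.seq (Exec.line (Q := I 0) ?_) fun σ₁ h₁ =>
    Exec.whileLt (N := σ.ireg 0) (T := 2 + (10 * σ.ireg 1 + 2 + 1)) I h₁ ?_ ?_) ?_ ?_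
  · refine ⟨⟨fun t ht => ?_, rfl, fun _ _ => rfl⟩, ?_, ?_, ?_⟩
    · have : t ≠ 23 := by omega
      simp [Instr.exec, this]
    all_goals simp [Instr.exec]
  · rintro C hC σ' ⟨hF, h22, h23, hm⟩
    have e0 := hF.ireg 0 (by norm_num)
    have e1 := hF.ireg 1 (by norm_num)
    have e5 := hF.ireg 5 (by norm_num)
    have e20 := hF.ireg 20 (by norm_num)
    have e21 := hF.ireg 21 (by norm_num)
    have hC2 : (C + 1) * σ.ireg 1 ≤ σ.ireg 0 * σ.ireg 1 := Nat.mul_le_mul_right _ hC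
    rw [Nat.succ_mul] at hC2
    refine ⟨by rw [h23, e0]; exact hC, ?_⟩
    refine Exec.seq (Exec.line (Q := fun σ'' => Frame 21 (σ.ireg 21) σ σ'' ∧
      σ''.ireg 22 = σ'.ireg 22 ∧ σ''.ireg 23 = C ∧ σ''.rmem = σ'.rmem ∧
      σ''.rreg 0 = σ.rmem (σ.ireg 20 + C)) ?_) fun σ₂ h₂ => ?_
    · refine ⟨⟨fun t ht => ?_, ?_, fun a ha => ?_⟩, ?_, ?_, ?_, ?_⟩
      · have h1 : t ≠ 27 := by omega
        simpa [Instr.exec, h1] using hF.ireg t ht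
      · simpa [Instr.exec] using hF.imem
      · simpa [Instr.exec] using hF.rmem a ha
      · simp [Instr.exec]
      · simpa [Instr.exec] using h23
      · simp [Instr.exec]
      · simpa [Instr.exec, e20, h23] using hF.rmem (σ.ireg 20 + C) (by omega)
    obtain ⟨hF₂, g22, g23, grm, gr0⟩ := h₂
    have f1 := hF₂.ireg 1 (by norm_num)
    have f5 := hF₂.ireg 5 (by norm_num)
    have f21 := hF₂.ireg 21 (by norm_num)
    have hcol := exec_addColumn σ₂ (by rw [f5, h5]) (by rw [g22, h22, f1, f21]; omega)
    rw [f1] at hcol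
    refine Exec.seq hcol fun σ₃ h₃ => Exec.line ?_
    obtain ⟨hF₃, k22, k23, km⟩ := h₃
    rw [f21] at hF₃ km
    have hFF := hF₂.trans hF₃
    refine ⟨⟨fun t ht => ?_, ?_, fun a ha => ?_⟩, ?_, ?_, fun i => ?_⟩
    · have h1 : t ≠ 23 := by omega
      simpa [Instr.exec, h1] using hFF.ireg t ht
    · simpa [Instr.exec] using hFF.imem
    · simpa [Instr.exec] using hFF.rmem a ha
    · simp [Instr.exec, k22, g22, h22, Nat.succ_mul]; ring
    · simp [Instr.exec, k23, g23, hFF.ireg 5 (by norm_num), h5]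
    · have hentry : (∑ j ∈ range (σ.ireg 1),
          if σ₂.imem (σ₂.ireg 22 + j) = i then σ₂.rmem (σ₂.ireg 22 + j) else 0)
          = storedEntry σ (σ.ireg 1) (σ.ireg 22) i C := by
        refine sum_congr rfl fun j hj => ?_
        have hj := mem_range.1 hj
        rw [g22, h22, hF₂.imem, hF₂.rmem _ (by omega)]
      have := km i
      rw [hentry, gr0, grm, hm i] at this
      simp only [List.foldl, Instr.exec]
      rw [this, sum_range_succ, add_assoc]
  · rintro σ' ⟨hF, -, h23, -⟩
    rw [h23, hF.ireg 0 (by norm_num)]; exact lt_irrefl _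
  · simp only [List.length_nil]
    ring_nf; omega
  · rintro σ' ⟨hF, h22, h23, hm⟩
    exact ⟨hF, h22, hm⟩

/-- Sets the result to zero. -/
def clear : Program :=
  .seq (line (.iconst 23 0) [.rconst 0 0])
    (.whileLt 23 0 (line (.iadd 26 21 23) [.rstore 26 0, .iadd 23 23 5]))

theorem exec_clear (σ : State) (h5 : σ.ireg 5 = 1) :
    Exec clear σ (σ.ireg 0 * 4 + 3) fun σ' =>
      Frame 22 (σ.ireg 21) σ σ' ∧ ∀ i < σ.ireg 0, σ'.rmem (σ.ireg 21 + i) = 0 := by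
  let I : ℕ → State → Prop := fun C σ' =>
    Frame 22 (σ.ireg 21) σ σ' ∧ σ'.ireg 23 = C ∧ σ'.rreg 0 = 0 ∧
      ∀ i < C, σ'.rmem (σ.ireg 21 + i) = 0
  refine Exec.mono (Exec.seq (Exec.line (Q := I 0) ?_) fun σ₁ h₁ =>
    Exec.whileLt (N := σ.ireg 0) (T := 3) I h₁ ?_ ?_) ?_ ?_
  · refine ⟨⟨fun t ht => ?_, rfl, fun _ _ => rfl⟩, ?_, ?_, ?_⟩
    · have : t ≠ 23 := by omega
      simp [Instr.exec, this]
    all_goals simp [Instr.exec]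
  · rintro C hC σ' ⟨hF, h23, hr0, hm⟩
    have e0 := hF.ireg 0 (by norm_num)
    have e5 := hF.ireg 5 (by norm_num)
    have e21 := hF.ireg 21 (by norm_num)
    refine ⟨by rw [h23, e0]; exact hC, Exec.line ?_⟩
    refine ⟨⟨fun t ht => ?_, ?_, fun a ha => ?_⟩, ?_, ?_, fun i hi => ?_⟩
    · have h1 : t ≠ 23 := by omega
      have h2 : t ≠ 26 := by omega
      simpa [Instr.exec, h1, h2] using hF.ireg t ht
    · simpa [Instr.exec] using hF.imem
    · have hne : a ≠ σ.ireg 21 + C := by omega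
      simpa [Instr.exec, e21, h23, hne] using hF.rmem a ha
    · simp [Instr.exec, h23, e5, h5]
    · simp [Instr.exec, hr0]
    · by_cases h : i = C
      · simp [Instr.exec, e21, h23, h, hr0]
      · simpa [Instr.exec, e21, h23, h] using hm i (by omega)
  · rintro σ' ⟨hF, h23, -⟩
    rw [h23, hF.ireg 0 (by norm_num)]; exact lt_irrefl _
  · simp only [List.length_nil, List.length_cons]
    omega
  · rintro σ' ⟨hF, h23, hr, hm⟩
    exact ⟨hF, hm⟩

/-- Applies the map stored at the address in register `9` to the vectors whose addresses are in
the registers `14` and `15`, and stores the result at the address in register `21`. -/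
def applyMap : Program :=
  .seq clear (.seq (line (.iadd 22 9 4) [.iadd 20 14 4]) (.seq matVec
    (.seq (line (.iadd 20 15 4) []) matVec)))

/-- The two products accumulate in the same cleared result. Adding register `4`, which holds zero,
serves as a copy instruction. -/
theorem exec_applyMap_stored (σ : State) (h4 : σ.ireg 4 = 0) (h5 : σ.ireg 5 = 1)
    (hptr : σ.ireg 9 + 2 * (σ.ireg 0 * σ.ireg 1) ≤ σ.ireg 21)
    (h14 : σ.ireg 14 + σ.ireg 0 ≤ σ.ireg 21) (h15 : σ.ireg 15 + σ.ireg 0 ≤ σ.ireg 21) :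
    Exec applyMap σ (σ.ireg 0 * (20 * σ.ireg 1 + 16) + 10) fun σ' =>
      Frame 19 (σ.ireg 21) σ σ' ∧
      ∀ i < σ.ireg 0, σ'.rmem (σ.ireg 21 + i) =
        ∑ c ∈ range (σ.ireg 0), storedEntry σ (σ.ireg 1) (σ.ireg 9) i c
          * σ.rmem (σ.ireg 14 + c) +
        ∑ c ∈ range (σ.ireg 0), storedEntry σ (σ.ireg 1) (σ.ireg 9 + σ.ireg 0 * σ.ireg 1) i c
          * σ.rmem (σ.ireg 15 + c) := by
  have hentry : ∀ σ' : State, Frame 19 (σ.ireg 21) σ σ' → ∀ ptr i,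
      ptr + σ.ireg 0 * σ.ireg 1 ≤ σ.ireg 21 → ∀ c < σ.ireg 0,
      storedEntry σ' (σ.ireg 1) ptr i c = storedEntry σ (σ.ireg 1) ptr i c := by
    intro σ' hF ptr i hp c hc
    refine sum_congr rfl fun j hj => ?_
    have hj := mem_range.1 hj
    have hC2 : (c + 1) * σ.ireg 1 ≤ σ.ireg 0 * σ.ireg 1 := Nat.mul_le_mul_right _ hc
    rw [Nat.succ_mul] at hC2
    rw [hF.imem, hF.rmem _ (by omega)]
  refine Exec.mono (T := (σ.ireg 0 * 4 + 3) + (2 + ((σ.ireg 0 * (10 * σ.ireg 1 + 6) + 2) +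
    (1 + (σ.ireg 0 * (10 * σ.ireg 1 + 6) + 2))))) (Exec.seq (exec_clear σ h5) ?_)
    (by ring_nf; omega) fun _ h => h
  rintro σ₁ ⟨hF₁, hz⟩
  have a0 := hF₁.ireg 0 (by norm_num)
  have a1 := hF₁.ireg 1 (by norm_num)
  have a4 := hF₁.ireg 4 (by norm_num)
  have a5 := hF₁.ireg 5 (by norm_num)
  have a9 := hF₁.ireg 9 (by norm_num)
  have a14 := hF₁.ireg 14 (by norm_num)
  have a15 := hF₁.ireg 15 (by norm_num)
  have a21 := hF₁.ireg 21 (by norm_num)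
  refine Exec.seq (Exec.line (Q := fun σ' => Frame 19 (σ.ireg 21) σ σ' ∧
    σ'.ireg 21 = σ.ireg 21 ∧ σ'.ireg 22 = σ.ireg 9 ∧ σ'.ireg 20 = σ.ireg 14 ∧
    ∀ i < σ.ireg 0, σ'.rmem (σ.ireg 21 + i) = 0) ?_) ?_
  · refine ⟨⟨fun t ht => ?_, ?_, fun a ha => ?_⟩, ?_, ?_, ?_, fun i hi => ?_⟩
    · have h1 : t ≠ 20 := by omega
      have h2 : t ≠ 22 := by omega
      simpa [Instr.exec, h1, h2] using hF₁.ireg t (by omega)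
    · simpa [Instr.exec] using hF₁.imem
    · simpa [Instr.exec] using hF₁.rmem a ha
    · simp [Instr.exec, a21]
    · simp [Instr.exec, a9, a4, h4]
    · simp [Instr.exec, a14, a4, h4]
    · simpa [Instr.exec] using hz i hi
  rintro σ₂ ⟨hF₂, b21, b22, b20, hz₂⟩
  have b0 := hF₂.ireg 0 (by norm_num)
  have b1 := hF₂.ireg 1 (by norm_num)
  have b5 := hF₂.ireg 5 (by norm_num)
  have hmv := exec_matVec σ₂ (by rw [b5, h5]) (by rw [b22, b0, b1, b21]; omega)
    (by rw [b20, b0, b21]; omega)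
  rw [b0, b1, b20, b21, b22] at hmv
  refine Exec.seq hmv ?_
  rintro σ₃ ⟨hF₃, c22, hm₃⟩
  have c21 : σ₃.ireg 21 = σ.ireg 21 := (hF₃.ireg 21 (by norm_num)).trans b21
  have hF₃' := hF₂.trans (hF₃.mono (by norm_num) le_rfl)
  refine Exec.seq (Exec.line (Q := fun σ' => Frame 19 (σ.ireg 21) σ σ' ∧
    σ'.ireg 21 = σ.ireg 21 ∧ σ'.ireg 22 = σ.ireg 9 + σ.ireg 0 * σ.ireg 1 ∧
    σ'.ireg 20 = σ.ireg 15 ∧ σ'.rmem = σ₃.rmem) ?_) ?_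
  · refine ⟨⟨fun t ht => ?_, ?_, fun a ha => ?_⟩, ?_, ?_, ?_, ?_⟩
    · have h1 : t ≠ 20 := by omega
      simpa [Instr.exec, h1] using hF₃'.ireg t ht
    · simpa [Instr.exec] using hF₃'.imem
    · simpa [Instr.exec] using hF₃'.rmem a ha
    · simp [Instr.exec, c21]
    · simp [Instr.exec, c22]
    · simp [Instr.exec, hF₃'.ireg 15 (by norm_num), hF₃'.ireg 4 (by norm_num), h4]
    · simp [Instr.exec]
  rintro σ₄ ⟨hF₄, d21, d22, d20, hm₄⟩
  have d0 := hF₄.ireg 0 (by norm_num)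
  have d1 := hF₄.ireg 1 (by norm_num)
  have d5 := hF₄.ireg 5 (by norm_num)
  have hmv := exec_matVec σ₄ (by rw [d5, h5]) (by rw [d22, d0, d1, d21]; omega)
    (by rw [d20, d0, d21]; omega)
  rw [d0, d1, d20, d21, d22] at hmv
  refine hmv.mono le_rfl ?_
  rintro σ₅ ⟨hF₅, -, hm₅⟩
  refine ⟨hF₄.trans (hF₅.mono (by norm_num) le_rfl), fun i hi => ?_⟩
  rw [hm₅, hm₄, hm₃, hz₂ i hi, zero_add]
  congr 1 <;> refine sum_congr rfl fun c hc => ?_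
  · have hc := mem_range.1 hc
    rw [hentry σ₂ hF₂ _ _ (by omega) c hc, hF₂.rmem _ (by omega)]
  · have hc := mem_range.1 hc
    rw [hentry σ₄ hF₄ _ _ (by omega) c hc, hF₃'.rmem _ (by omega)]

/-! ### Application of a stored map -/

/-- The vector `v` is stored in the real memory at the address `p`. -/
def HoldsVec {d : ℕ} (v : Vec d) (p : ℕ) (σ : State) : Prop := ∀ i : Fin d, σ.rmem (p + i) = v i

theorem HoldsVec.frame {d n D p : ℕ} {v : Vec d} {σ σ' : State} (h : HoldsVec v p σ)
    (hF : Frame n D σ σ') (hp : p + d ≤ D) : HoldsVec v p σ' := fun i => by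
  rw [hF.rmem _ (by omega), h i]

/-- The map `q` is stored in sparse form at the address `p`. -/
def HoldsMap {d s : ℕ} (q : MapSeed d s) (p : ℕ) (σ : State) : Prop :=
  ∀ (b : Fin 2) (c : Fin d) (j : Fin s),
    σ.imem (p + b * (d * s) + c * s + j) = ((q b c).rows.orderEmbOfFin (q b c).card_rows j : Fin d) ∧
    σ.rmem (p + b * (d * s) + c * s + j) =
      (q b c).value ((q b c).rows.orderEmbOfFin (q b c).card_rows j)

theorem matrix_address_lt {d s : ℕ} (b : Fin 2) (c : Fin d) (j : Fin s) :
    b * (d * s) + c * s + j < 2 * (d * s) := by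
  have h1 : ((c : ℕ) + 1) * s ≤ d * s := Nat.mul_le_mul_right _ c.2
  have h2 : (b : ℕ) * (d * s) ≤ 1 * (d * s) := Nat.mul_le_mul_right _ (by omega)
  have := j.2
  rw [Nat.succ_mul] at h1
  omega

theorem HoldsMap.congr {d s p : ℕ} {q : MapSeed d s} {σ σ' : State} (h : HoldsMap q p σ)
    (hi : ∀ a < p + 2 * (d * s), σ'.imem a = σ.imem a)
    (hr : ∀ a < p + 2 * (d * s), σ'.rmem a = σ.rmem a) : HoldsMap q p σ' := fun b c j => by
  have := matrix_address_lt b c j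
  rw [hi _ (by omega), hr _ (by omega)]
  exact h b c j

/-- The increasing enumeration runs through each nonzero position once, so reindexing by the
positions leaves at most one term. -/
theorem ColumnSeed.sum_rows {d s : ℕ} (q : ColumnSeed d s) (i : Fin d) :
    ∑ j : Fin s, (if ((q.rows.orderEmbOfFin q.card_rows j : Fin d) : ℕ) = i then
      q.value (q.rows.orderEmbOfFin q.card_rows j) else 0) = if i ∈ q.rows then q.value i else 0 := by
  have h := sum_map univ (q.rows.orderEmbOfFin q.card_rows).toEmbedding
    fun r => if r = i then q.value r else 0
  rw [map_orderEmbOfFin_univ] at h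
  simp only [RelEmbedding.coe_toEmbedding] at h
  simp only [Fin.val_inj]
  rw [← h]
  simp

theorem HoldsMap.storedEntry_eq {d s p : ℕ} {q : MapSeed d s} {σ : State} (h : HoldsMap q p σ)
    (b : Fin 2) (i c : Fin d) : storedEntry σ s (p + b * (d * s)) i c = q.matrix b i c := by
  rw [storedEntry, Finset.sum_range, MapSeed.matrix, Matrix.of_apply, ← ColumnSeed.sum_rows]
  refine sum_congr rfl fun j _ => ?_
  rw [(h b c j).1, (h b c j).2]

theorem exec_applyMap {d s : ℕ} (q : MapSeed d s) (v w : Vec d) (σ : State) (h0 : σ.ireg 0 = d)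
    (h1 : σ.ireg 1 = s) (h4 : σ.ireg 4 = 0) (h5 : σ.ireg 5 = 1) (hq : HoldsMap q (σ.ireg 9) σ)
    (hv : HoldsVec v (σ.ireg 14) σ) (hw : HoldsVec w (σ.ireg 15) σ)
    (hptr : σ.ireg 9 + 2 * (d * s) ≤ σ.ireg 21)
    (h14 : σ.ireg 14 + d ≤ σ.ireg 21) (h15 : σ.ireg 15 + d ≤ σ.ireg 21) :
    Exec applyMap σ (d * (20 * s + 16) + 10) fun σ' =>
      Frame 19 (σ.ireg 21) σ σ' ∧ HoldsVec (q.toMap (v, w)) (σ.ireg 21) σ' := by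
  have h := exec_applyMap_stored σ h4 h5 (by rwa [h0, h1]) (by rwa [h0]) (by rwa [h0])
  rw [h0, h1] at h
  refine h.mono le_rfl ?_
  rintro σ' ⟨hF, hm⟩
  refine ⟨hF, fun i => ?_⟩
  rw [hm i i.2, Finset.sum_range, Finset.sum_range]
  simp only [MapSeed.toMap, LinearMap.coprod_apply, PiLp.add_apply, Matrix.toLpLin_apply,
    Matrix.mulVec, dotProduct]
  congr 1 <;> refine sum_congr rfl fun c _ => ?_
  · rw [hv c, ← hq.storedEntry_eq]; simp
  · rw [hw c, ← hq.storedEntry_eq]; simp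

/-! ### One level of the recursion -/

/-- The argument of the procedure `Project` after `j` recursive calls. -/
def resid (d k x : ℕ) : ℕ → ℕ
  | 0 => x
  | j + 1 => if resid d k x j < d * 2 ^ (k - 1 - j) then resid d k x j
      else resid d k x j - d * 2 ^ (k - 1 - j)

/-- Which case of the procedure `Project` applies at level `c`. -/
def flag (d k x c : ℕ) : ℕ := if resid d k x (k - 1 - c) < d * 2 ^ c then 0 else 1

/-- The argument of `project` at level `c` is fixed by the `k - c` calls above it. Once these
arguments and cases are known, the recursion can be evaluated as a loop from level zero upwards. -/
theorem project_succ_resid {k d : ℕ} (φ : Fin k → (Vec d × Vec d →ₗ[ℝ] Vec d)) (x c : ℕ)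
    (h : c + 1 ≤ k) :
    project φ (c + 1) h (resid d k x (k - (c + 1))) =
      if flag d k x c = 0 then φ ⟨c, h⟩ (project φ c (by omega) (resid d k x (k - c)), 0)
      else φ ⟨c, h⟩ (preprocess φ c (by omega), project φ c (by omega) (resid d k x (k - c))) := by
  have h1 : k - (c + 1) = k - 1 - c := by omega
  have h2 : k - c = (k - 1 - c) + 1 := by omega
  have h3 : k - 1 - (k - 1 - c) = c := by omega
  rw [project, h1, h2, resid, h3, flag]
  split_ifs with hlt
  · rfl
  · contradiction
  · contradiction
  · rfl

/-- One level of the recursion: registers `11` and `12` hold the addresses of the preprocessed and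
of the projected vector, `10` that of the zero vector, `9` that of the map, `13` that of the flag,
`6` the size of a map and `8` the level. -/
def levelBody : Program :=
  .seq (line (.iadd 16 12 0) [.iadd 17 16 0, .iadd 14 11 4, .iadd 15 11 4, .iadd 21 16 4])
  (.seq applyMap
  (.seq (line (.iload 18 13) [])
  (.seq (.ifLt 4 18 (line (.iadd 14 11 4) [.iadd 15 12 4]) (line (.iadd 14 12 4) [.iadd 15 10 4]))
  (.seq (line (.iadd 21 17 4) [])
  (.seq applyMap
  (line (.iadd 11 16 4) [.iadd 12 17 4, .iadd 9 9 6, .iadd 13 13 5, .iadd 8 8 5]))))))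

/-- The registers and memory cells that hold constants throughout, with the input below `F`. -/
structure Base (d s k F : ℕ) (σ₀ σ : State) : Prop where
  r0 : σ.ireg 0 = d
  r1 : σ.ireg 1 = s
  r2 : σ.ireg 2 = k
  r4 : σ.ireg 4 = 0
  r5 : σ.ireg 5 = 1
  r6 : σ.ireg 6 = 2 * (d * s)
  imem : ∀ a < F, σ.imem a = σ₀.imem a
  rmem : ∀ a < F, σ.rmem a = σ₀.rmem a

/-- The state before level `c`. -/
structure LevelInv {k d s : ℕ} (q : Fin k → MapSeed d s) (x : ℕ) (σ₀ : State) (c : ℕ)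
    (σ : State) : Prop where
  base : Base d s k (k * (2 * (d * s))) σ₀ σ
  le : c ≤ k
  r8 : σ.ireg 8 = c
  r9 : σ.ireg 9 = c * (2 * (d * s))
  r10 : k * (2 * (d * s)) ≤ σ.ireg 10
  r10_le : σ.ireg 10 ≤ σ.ireg 12
  r11_le : σ.ireg 11 ≤ σ.ireg 12
  r13 : σ.ireg 13 = k * (2 * (d * s)) + c
  flags : ∀ c < k, σ.imem (k * (2 * (d * s)) + c) = flag d k x c
  zero : HoldsVec (0 : Vec d) (σ.ireg 10) σ
  pre : HoldsVec (preprocess (fun i => (q i).toMap) c le) (σ.ireg 11) σ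
  proj : HoldsVec (project (fun i => (q i).toMap) c le (resid d k x (k - c))) (σ.ireg 12) σ

/-- Real memory is never reused: with the latest projected vector at `A`, the new preprocessed and
projected vectors go to `A + d` and `A + d + d`. The old preprocessed vector, which the second
application may still need, stays intact, as do the input and the zero vector. -/
theorem exec_levelBody {k d s : ℕ} (q : Fin k → MapSeed d s) (x : ℕ) (σ₀ : State)
    (hq : ∀ l : Fin k, HoldsMap (q l) (l * (2 * (d * s))) σ₀) (c : ℕ) (hc : c < k) (σ : State)
    (h : LevelInv q x σ₀ c σ) :
    Exec levelBody σ (2 * (d * (20 * s + 16)) + 40) (LevelInv q x σ₀ (c + 1)) := by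
  obtain ⟨⟨r0, r1, r2, r4, r5, r6, him, hrm⟩, hle, r8, r9, r10, r10_le, r11_le, r13, flags, zero,
    pre, proj⟩ := h
  set A := σ.ireg 12 with hA
  have hF1 : c * (2 * (d * s)) + 2 * (d * s) ≤ k * (2 * (d * s)) := by
    rw [← Nat.succ_mul]; exact Nat.mul_le_mul_right _ hc
  have hmap : HoldsMap (q ⟨c, hc⟩) (σ.ireg 9) σ := by
    rw [r9]
    exact (hq ⟨c, hc⟩).congr (fun a ha => him a (by simp only at ha; omega))
      (fun a ha => hrm a (by simp only at ha; omega))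
  refine Exec.mono (T := 5 + ((d * (20 * s + 16) + 10) + (1 + ((2 + 1) + (1 +
    ((d * (20 * s + 16) + 10) + 5)))))) ?_ (by omega) fun _ h => h
  refine Exec.seq (Exec.line (Q := fun σ' => Frame 13 (A + d) σ σ' ∧ σ'.ireg 16 = A + d ∧
    σ'.ireg 17 = A + d + d ∧ σ'.ireg 14 = σ.ireg 11 ∧ σ'.ireg 15 = σ.ireg 11 ∧
    σ'.ireg 21 = A + d) ?_) ?_
  · refine ⟨⟨fun t ht => ?_, ?_, fun a ha => ?_⟩, ?_, ?_, ?_, ?_, ?_⟩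
    · have h1 : t ≠ 14 := by omega
      have h2 : t ≠ 15 := by omega
      have h3 : t ≠ 16 := by omega
      have h4 : t ≠ 17 := by omega
      have h5 : t ≠ 21 := by omega
      simp [Instr.exec, h1, h2, h3, h4, h5]
    all_goals simp [Instr.exec, r0, r4, hA]
  rintro σ₁ ⟨hF₁, a16, a17, a14, a15, a21⟩
  have hmap₁ : HoldsMap (q ⟨c, hc⟩) (σ₁.ireg 9) σ₁ := by
    rw [hF₁.ireg 9 (by norm_num)]
    exact hmap.congr (fun a _ => by rw [hF₁.imem]) (fun a ha => hF₁.rmem a (by omega))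
  have happ := exec_applyMap (q ⟨c, hc⟩) _ _ σ₁ ((hF₁.ireg 0 (by norm_num)).trans r0)
    ((hF₁.ireg 1 (by norm_num)).trans r1) ((hF₁.ireg 4 (by norm_num)).trans r4)
    ((hF₁.ireg 5 (by norm_num)).trans r5) hmap₁
    (by rw [a14]; exact pre.frame hF₁ (by omega)) (by rw [a15]; exact pre.frame hF₁ (by omega))
    (by rw [hF₁.ireg 9 (by norm_num), a21]; omega) (by rw [a14, a21]; omega)
    (by rw [a15, a21]; omega)
  rw [a21] at happ
  refine Exec.seq happ ?_
  rintro σ₂ ⟨hF₂, hpre⟩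
  have b16 := (hF₂.ireg 16 (by norm_num)).trans a16
  have b17 := (hF₂.ireg 17 (by norm_num)).trans a17
  replace hF₂ := hF₁.trans (hF₂.mono (by norm_num) le_rfl)
  refine Exec.seq (Exec.line (Q := fun σ' => Frame 13 (A + d) σ σ' ∧ σ'.ireg 16 = A + d ∧
    σ'.ireg 17 = A + d + d ∧ σ'.ireg 18 = flag d k x c ∧ σ'.rmem = σ₂.rmem) ?_) ?_
  · refine ⟨⟨fun t ht => ?_, ?_, fun a ha => ?_⟩, ?_, ?_, ?_, ?_⟩
    · have h1 : t ≠ 18 := by omega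
      simpa [Instr.exec, h1] using hF₂.ireg t ht
    · simpa [Instr.exec] using hF₂.imem
    · simpa [Instr.exec] using hF₂.rmem a ha
    · simp [Instr.exec, b16]
    · simp [Instr.exec, b17]
    · simp [Instr.exec, hF₂.ireg 13 (by norm_num), hF₂.imem, r13, flags c hc]
    · simp [Instr.exec]
  rintro σ₃ ⟨hF₃, c16, c17, c18, crm⟩
  have c4 := (hF₃.ireg 4 (by norm_num)).trans r4
  refine Exec.seq (Q := fun σ' => Frame 13 (A + d) σ σ' ∧ σ'.ireg 16 = A + d ∧
    σ'.ireg 17 = A + d + d ∧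
    σ'.ireg 14 = (if flag d k x c = 0 then σ.ireg 12 else σ.ireg 11) ∧
    σ'.ireg 15 = (if flag d k x c = 0 then σ.ireg 10 else σ.ireg 12) ∧ σ'.rmem = σ₂.rmem)
    (Exec.ifLt (fun hlt => Exec.line ?_) (fun hlt => Exec.line ?_)) ?_
  · rw [c4, c18] at hlt
    refine ⟨⟨fun t ht => ?_, ?_, fun a ha => ?_⟩, ?_, ?_, ?_, ?_, ?_⟩
    · have h1 : t ≠ 14 := by omega
      have h2 : t ≠ 15 := by omega
      simpa [Instr.exec, h1, h2] using hF₃.ireg t ht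
    · simpa [Instr.exec] using hF₃.imem
    · simpa [Instr.exec] using hF₃.rmem a ha
    · simp [Instr.exec, c16]
    · simp [Instr.exec, c17]
    · simp [Instr.exec, c4, hF₃.ireg 11 (by norm_num), hlt.ne']
    · simp [Instr.exec, c4, hF₃.ireg 12 (by norm_num), hlt.ne']
    · simp [Instr.exec, crm]
  · rw [c4, c18] at hlt
    have hlt : flag d k x c = 0 := by omega
    refine ⟨⟨fun t ht => ?_, ?_, fun a ha => ?_⟩, ?_, ?_, ?_, ?_, ?_⟩
    · have h1 : t ≠ 14 := by omega
      have h2 : t ≠ 15 := by omega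
      simpa [Instr.exec, h1, h2] using hF₃.ireg t ht
    · simpa [Instr.exec] using hF₃.imem
    · simpa [Instr.exec] using hF₃.rmem a ha
    · simp [Instr.exec, c16]
    · simp [Instr.exec, c17]
    · simp [Instr.exec, c4, hF₃.ireg 12 (by norm_num), hlt]
    · simp [Instr.exec, c4, hF₃.ireg 10 (by norm_num), hlt]
    · simp [Instr.exec, crm]
  rintro σ₄ ⟨hF₄, d16, d17, d14, d15, drm⟩
  have d4 := (hF₄.ireg 4 (by norm_num)).trans r4
  refine Exec.seq (Exec.line (Q := fun σ' => Frame 13 (A + d) σ σ' ∧ σ'.ireg 16 = A + d ∧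
    σ'.ireg 17 = A + d + d ∧ σ'.ireg 14 = (if flag d k x c = 0 then σ.ireg 12 else σ.ireg 11) ∧
    σ'.ireg 15 = (if flag d k x c = 0 then σ.ireg 10 else σ.ireg 12) ∧
    σ'.ireg 21 = A + d + d ∧ σ'.rmem = σ₂.rmem) ?_) ?_
  · refine ⟨⟨fun t ht => ?_, ?_, fun a ha => ?_⟩, ?_, ?_, ?_, ?_, ?_, ?_⟩
    · have h1 : t ≠ 21 := by omega
      simpa [Instr.exec, h1] using hF₄.ireg t ht
    · simpa [Instr.exec] using hF₄.imem
    · simpa [Instr.exec] using hF₄.rmem a ha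
    all_goals simp [Instr.exec, d16, d17, d4, d14, d15, drm]
  rintro σ₅ ⟨hF₅, e16, e17, e14, e15, e21, erm⟩
  have hmap₅ : HoldsMap (q ⟨c, hc⟩) (σ₅.ireg 9) σ₅ := by
    rw [hF₅.ireg 9 (by norm_num)]
    exact hmap.congr (fun a _ => by rw [hF₅.imem]) (fun a ha => hF₅.rmem a (by omega))
  have happ := exec_applyMap (q ⟨c, hc⟩)
    (if flag d k x c = 0 then project (fun i => (q i).toMap) c hle (resid d k x (k - c)) else
      preprocess (fun i => (q i).toMap) c hle)
    (if flag d k x c = 0 then 0 else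
      project (fun i => (q i).toMap) c hle (resid d k x (k - c))) σ₅
    ((hF₅.ireg 0 (by norm_num)).trans r0)
    ((hF₅.ireg 1 (by norm_num)).trans r1) ((hF₅.ireg 4 (by norm_num)).trans r4)
    ((hF₅.ireg 5 (by norm_num)).trans r5) hmap₅
    (by
      rw [e14]
      split_ifs
      · exact proj.frame hF₅ (by omega)
      · exact pre.frame hF₅ (by omega))
    (by
      rw [e15]
      split_ifs
      · exact zero.frame hF₅ (by omega)
      · exact proj.frame hF₅ (by omega))
    (by rw [hF₅.ireg 9 (by norm_num), e21]; omega) (by rw [e14, e21]; split_ifs <;> omega)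
    (by rw [e15, e21]; split_ifs <;> omega)
  rw [e21] at happ
  refine Exec.seq happ ?_
  rintro σ₆ ⟨hF₆, hproj⟩
  have f16 := (hF₆.ireg 16 (by norm_num)).trans e16
  have f17 := (hF₆.ireg 17 (by norm_num)).trans e17
  have hpre₆ : HoldsVec (preprocess (fun i => (q i).toMap) (c + 1) hc) (A + d) σ₆ := fun i => by
    rw [hF₆.rmem _ (by omega), erm]
    exact hpre i
  have hproj₆ : HoldsVec (project (fun i => (q i).toMap) (c + 1) hc
      (resid d k x (k - (c + 1)))) (A + d + d) σ₆ := by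
    rw [project_succ_resid]
    split_ifs with hf
    · simpa only [if_pos hf] using hproj
    · simpa only [if_neg hf] using hproj
  replace hF₆ := hF₅.trans (hF₆.mono (n' := 13) (D' := A + d) (by norm_num) (by omega))
  have f4 := (hF₆.ireg 4 (by norm_num)).trans r4
  have f5 := (hF₆.ireg 5 (by norm_num)).trans r5
  have f6 := (hF₆.ireg 6 (by norm_num)).trans r6
  refine Exec.line ⟨⟨?_, ?_, ?_, ?_, ?_, ?_, fun a ha => ?_, fun a ha => ?_⟩, hc, ?_, ?_, ?_, ?_, ?_,
    ?_, fun c' hc' => ?_, fun i => ?_, fun i => ?_, fun i => ?_⟩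
  · simp [Instr.exec, hF₆.ireg, r0]
  · simp [Instr.exec, hF₆.ireg, r1]
  · simp [Instr.exec, hF₆.ireg, r2]
  · simp [Instr.exec, f4]
  · simp [Instr.exec, f5]
  · simp [Instr.exec, f6]
  · simp [Instr.exec, hF₆.imem, him a ha]
  · simpa [Instr.exec, hrm a ha] using hF₆.rmem a (by omega)
  · simp [Instr.exec, f5, hF₆.ireg, r8]
  · simp [Instr.exec, f6, hF₆.ireg, r9, Nat.succ_mul]
  · simpa [Instr.exec, hF₆.ireg] using r10
  · simp [Instr.exec, hF₆.ireg, f17]; omega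
  · simp [Instr.exec, f16, f17, f4]
  · simp [Instr.exec, f5, hF₆.ireg, r13]; ring
  · simp [Instr.exec, hF₆.imem, flags c' hc']
  · simpa [Instr.exec, hF₆.ireg] using zero.frame hF₆ (by omega) i
  · simpa [Instr.exec, f16, f4] using hpre₆ i
  · simpa [Instr.exec, f17, f4] using hproj₆ i

/-! ### Initialization -/

theorem Base.of_agree {d s k F : ℕ} {σ₀ σ σ' : State} (h : Base d s k F σ₀ σ)
    (hreg : ∀ t ≤ 6, σ'.ireg t = σ.ireg t) (him : ∀ a < F, σ'.imem a = σ.imem a)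
    (hrm : ∀ a < F, σ'.rmem a = σ.rmem a) : Base d s k F σ₀ σ' where
  r0 := (hreg 0 (by norm_num)).trans h.r0
  r1 := (hreg 1 (by norm_num)).trans h.r1
  r2 := (hreg 2 (by norm_num)).trans h.r2
  r4 := (hreg 4 (by norm_num)).trans h.r4
  r5 := (hreg 5 (by norm_num)).trans h.r5
  r6 := (hreg 6 (by norm_num)).trans h.r6
  imem := fun a ha => (him a ha).trans (h.imem a ha)
  rmem := fun a ha => (hrm a ha).trans (h.rmem a ha)

/-- Computes the size of one map and the total size of the input. -/
def computeSizes : Program :=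
  .seq (line (.iconst 4 0) [.iconst 5 1, .iconst 6 0, .iconst 7 0])
  (.seq (.whileLt 7 0 (line (.iadd 6 6 1) [.iadd 6 6 1, .iadd 7 7 5]))
  (.seq (line (.iconst 10 0) [.iconst 8 0])
  (.whileLt 8 2 (line (.iadd 10 10 6) [.iadd 8 8 5]))))

/-- Integers cannot be multiplied in one step, so the products arise by repeated addition, in time
linear in `d` and `k`. -/
theorem exec_computeSizes {d s k x : ℕ} (σ : State) (r0 : σ.ireg 0 = d) (r1 : σ.ireg 1 = s)
    (r2 : σ.ireg 2 = k) (r3 : σ.ireg 3 = x) :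
    Exec computeSizes σ (4 * d + 3 * k + 8) fun σ' =>
      Base d s k (k * (2 * (d * s))) σ σ' ∧ σ'.ireg 3 = x ∧
        σ'.ireg 10 = k * (2 * (d * s)) := by
  let I : ℕ → State → Prop := fun j σ' =>
    σ'.ireg 0 = d ∧ σ'.ireg 1 = s ∧ σ'.ireg 2 = k ∧ σ'.ireg 3 = x ∧ σ'.ireg 4 = 0 ∧
      σ'.ireg 5 = 1 ∧ σ'.ireg 6 = 2 * (j * s) ∧ σ'.ireg 7 = j ∧ σ'.imem = σ.imem ∧
      σ'.rmem = σ.rmem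
  let J : ℕ → State → Prop := fun j σ' =>
    Base d s k (k * (2 * (d * s))) σ σ' ∧ σ'.ireg 3 = x ∧ σ'.ireg 10 = j * (2 * (d * s)) ∧
      σ'.ireg 8 = j
  refine Exec.mono (T := 4 + ((d * (3 + 1) + 1) + (2 + (k * (2 + 1) + 1)))) (Q := J k)
    (Exec.seq (Exec.line (Q := I 0) ?_) fun σ₁ h₁ => Exec.seq (Q := I d)
      (Exec.whileLt I h₁ ?_ ?_) fun σ₂ h₂ => Exec.seq (Exec.line (Q := J 0) ?_) fun σ₃ h₃ =>
      Exec.whileLt J h₃ ?_ ?_) (by omega) ?_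
  · simp [I, Instr.exec, r0, r1, r2, r3]
  · rintro j hj σ' ⟨h0, h1, h2, h3, h4, h5, h6, h7, him, hrm⟩
    refine ⟨by rw [h7, h0]; exact hj, Exec.line ?_⟩
    simp [I, Instr.exec, h0, h1, h2, h3, h4, h5, h6, h7, him, hrm]
    ring
  · rintro σ' ⟨h0, -, -, -, -, -, -, h7, -⟩
    rw [h7, h0]; exact lt_irrefl _
  · obtain ⟨h0, h1, h2, h3, h4, h5, h6, h7, him, hrm⟩ := h₂
    refine ⟨⟨?_, ?_, ?_, ?_, ?_, ?_, ?_, ?_⟩, ?_, ?_, ?_⟩ <;>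
      simp [Instr.exec, h0, h1, h2, h3, h4, h5, h6, him, hrm]
  · rintro j hj σ' ⟨hB, h3, h10, h8⟩
    refine ⟨by rw [h8, hB.r2]; exact hj, Exec.line ⟨hB.of_agree (fun t ht => ?_) ?_ ?_, ?_, ?_, ?_⟩⟩
    · have e1 : t ≠ 8 := by omega
      have e2 : t ≠ 10 := by omega
      simp [Instr.exec, e1, e2]
    · simp [Instr.exec]
    · simp [Instr.exec]
    · simp [Instr.exec, h3]
    · simp [Instr.exec, h10, hB.r6, Nat.succ_mul]
    · simp [Instr.exec, h8, hB.r5]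
  · rintro σ' ⟨hB, -, -, h8⟩
    rw [h8, hB.r2]; exact lt_irrefl _
  · rintro σ' ⟨hB, h3, h10, h8⟩
    exact ⟨hB, h3, h10⟩

/-- Stores the lengths `d * 2 ^ c` behind the input. -/
def computePowers : Program :=
  .seq (line (.iadd 13 10 4) [.iadd 14 0 4, .iconst 8 0])
  (.whileLt 8 2 (line (.istore 13 14) [.iadd 14 14 14, .iadd 13 13 5, .iadd 8 8 5]))

/-- The lengths are needed from the largest down, but the machine cannot halve. They are produced by
doubling and kept in integer memory. -/
theorem exec_computePowers {d s k x F : ℕ} (σ₀ σ : State) (hB : Base d s k F σ₀ σ)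
    (h3 : σ.ireg 3 = x) (h10 : σ.ireg 10 = F) :
    Exec computePowers σ (5 * k + 4) fun σ' =>
      Base d s k F σ₀ σ' ∧ σ'.ireg 3 = x ∧ σ'.ireg 10 = F ∧ σ'.ireg 13 = F + k ∧
        ∀ c < k, σ'.imem (F + c) = d * 2 ^ c := by
  let I : ℕ → State → Prop := fun j σ' =>
    Base d s k F σ₀ σ' ∧ σ'.ireg 3 = x ∧ σ'.ireg 10 = F ∧ σ'.ireg 13 = F + j ∧
      σ'.ireg 14 = d * 2 ^ j ∧ σ'.ireg 8 = j ∧ ∀ c < j, σ'.imem (F + c) = d * 2 ^ c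
  refine Exec.mono (T := 3 + (k * (4 + 1) + 1)) (Q := I k)
    (Exec.seq (Exec.line (Q := I 0) ?_) fun σ₁ h₁ => Exec.whileLt I h₁ ?_ ?_) (by omega) ?_
  · refine ⟨hB.of_agree (fun t ht => ?_) ?_ ?_, ?_, ?_, ?_, ?_, ?_, ?_⟩
    · have e1 : t ≠ 8 := by omega
      have e2 : t ≠ 13 := by omega
      have e3 : t ≠ 14 := by omega
      simp [Instr.exec, e1, e2, e3]
    all_goals simp [Instr.exec, h3, h10, hB.r4, hB.r0]
  · rintro j hj σ' ⟨hB, h3, h10, h13, h14, h8, hm⟩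
    refine ⟨by rw [h8, hB.r2]; exact hj, Exec.line ⟨hB.of_agree (fun t ht => ?_)
      (fun a ha => ?_) ?_, ?_, ?_, ?_, ?_, ?_, fun c hc => ?_⟩⟩
    · have e1 : t ≠ 8 := by omega
      have e2 : t ≠ 13 := by omega
      have e3 : t ≠ 14 := by omega
      simp [Instr.exec, e1, e2, e3]
    · have e1 : a ≠ F + j := by omega
      simp [Instr.exec, h13, e1]
    · simp [Instr.exec]
    · simp [Instr.exec, h3]
    · simp [Instr.exec, h10]
    · simp [Instr.exec, h13, hB.r5]; ring
    · simp [Instr.exec, h14]; ring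
    · simp [Instr.exec, h8, hB.r5]
    · by_cases e : c = j
      · simp [Instr.exec, h13, e, h14]
      · simpa [Instr.exec, h13, e] using hm c (by omega)
  · rintro σ' ⟨hB, -, -, -, -, h8, -⟩
    rw [h8, hB.r2]; exact lt_irrefl _
  · rintro σ' ⟨hB, h3, h10, h13, h14, h8, hm⟩
    exact ⟨hB, h3, h10, h13, hm⟩

/-- Replaces the lengths by the flags. -/
def computeFlags : Program :=
  .seq (line (.iadd 15 3 4) [])
  (.whileLt 10 13 (.seq (line (.isub 13 13 5) [.iload 14 13])
    (.ifLt 15 14 (line (.istore 13 4) []) (line (.isub 15 15 14) [.istore 13 5]))))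

/-- Descending through the levels, each length is read once and its cell then receives the flag.
After `j` rounds the cells below `k - j` still hold lengths and those above hold flags; register
`15` ends with the argument for level zero. -/
theorem exec_computeFlags {d s k x F : ℕ} (σ₀ σ : State) (hB : Base d s k F σ₀ σ)
    (h3 : σ.ireg 3 = x) (h10 : σ.ireg 10 = F) (h13 : σ.ireg 13 = F + k)
    (hm : ∀ c < k, σ.imem (F + c) = d * 2 ^ c) :
    Exec computeFlags σ (6 * k + 2) fun σ' =>
      Base d s k F σ₀ σ' ∧ σ'.ireg 10 = F ∧ σ'.ireg 13 = F ∧ σ'.ireg 15 = resid d k x k ∧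
        ∀ c < k, σ'.imem (F + c) = flag d k x c := by
  let I : ℕ → State → Prop := fun j σ' =>
    Base d s k F σ₀ σ' ∧ σ'.ireg 10 = F ∧ σ'.ireg 13 = F + (k - j) ∧ σ'.ireg 15 = resid d k x j ∧
      (∀ c < k - j, σ'.imem (F + c) = d * 2 ^ c) ∧
      ∀ c < k, k - j ≤ c → σ'.imem (F + c) = flag d k x c
  refine Exec.mono (T := 1 + (k * (2 + (2 + 1) + 1) + 1)) (Q := I k)
    (Exec.seq (Exec.line (Q := I 0) ?_) fun σ₁ h₁ => Exec.whileLt I h₁ ?_ ?_) (by omega) ?_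
  · refine ⟨hB.of_agree (fun t ht => ?_) ?_ ?_, ?_, ?_, ?_, ?_, fun c hc hc' => ?_⟩
    · have e1 : t ≠ 15 := by omega
      simp [Instr.exec, e1]
    · simp [Instr.exec]
    · simp [Instr.exec]
    · simp [Instr.exec, h10]
    · simp [Instr.exec, h13]
    · simp [Instr.exec, h3, hB.r4, resid]
    · simpa [Instr.exec] using hm
    · omega
  · rintro j hj σ₁ ⟨hB, h10, h13, h15, hp, hf⟩
    refine ⟨by rw [h10, h13]; omega, ?_⟩
    have hkj : k - (j + 1) = k - 1 - j := by omega
    refine Exec.seq (Exec.line (Q := fun σ' => Base d s k F σ₀ σ' ∧ σ'.ireg 10 = F ∧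
      σ'.ireg 13 = F + (k - 1 - j) ∧ σ'.ireg 14 = d * 2 ^ (k - 1 - j) ∧
      σ'.ireg 15 = resid d k x j ∧ σ'.imem = σ₁.imem) ?_) ?_
    · have e0 : F + (k - j) - 1 = F + (k - 1 - j) := by omega
      refine ⟨hB.of_agree (fun t ht => ?_) ?_ ?_, ?_, ?_, ?_, ?_, ?_⟩
      · have e1 : t ≠ 13 := by omega
        have e2 : t ≠ 14 := by omega
        simp [Instr.exec, e1, e2]
      · simp [Instr.exec]
      · simp [Instr.exec]
      · simp [Instr.exec, h10]
      · simp [Instr.exec, h13, hB.r5, e0]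
      · simpa [Instr.exec, h13, hB.r5, e0] using hp (k - 1 - j) (by omega)
      · simp [Instr.exec, h15]
      · simp [Instr.exec]
    rintro σ₂ ⟨hB, h10, h13, h14, h15, him⟩
    have hidx : k - 1 - (k - 1 - j) = j := by omega
    refine Exec.ifLt (fun hlt => Exec.mono (Exec.line ?_) (by simp) fun _ h => h)
      (fun hlt => Exec.line ?_)
    · rw [h15, h14] at hlt
      refine ⟨hB.of_agree (fun t ht => ?_) (fun a ha => ?_) ?_, ?_, ?_, ?_, fun c hc => ?_,
        fun c hc hc' => ?_⟩
      · simp [Instr.exec]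
      · have e1 : a ≠ F + (k - 1 - j) := by omega
        simp [Instr.exec, h13, e1]
      · simp [Instr.exec]
      · simp [Instr.exec, h10]
      · simp [Instr.exec, h13, hkj]
      · simp [Instr.exec, h15, resid, hlt]
      · have e1 : c ≠ k - 1 - j := by omega
        simpa [Instr.exec, h13, e1, him] using hp c (by omega)
      · by_cases e : c = k - 1 - j
        · simp [Instr.exec, h13, e, flag, hidx, hlt, hB.r4]
        · simpa [Instr.exec, h13, e, him] using hf c hc (by omega)
    · rw [h15, h14] at hlt
      refine ⟨hB.of_agree (fun t ht => ?_) (fun a ha => ?_) ?_, ?_, ?_, ?_, fun c hc => ?_,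
        fun c hc hc' => ?_⟩
      · have e1 : t ≠ 15 := by omega
        simp [Instr.exec, e1]
      · have e1 : a ≠ F + (k - 1 - j) := by omega
        simp [Instr.exec, h13, e1]
      · simp [Instr.exec]
      · simp [Instr.exec, h10]
      · simp [Instr.exec, h13, hkj]
      · simp only [resid, if_neg hlt]
        simp [Instr.exec, h15, h14]
      · have e1 : c ≠ k - 1 - j := by omega
        simpa [Instr.exec, h13, e1, him] using hp c (by omega)
      · by_cases e : c = k - 1 - j
        · simp only [e, flag, hidx, if_neg hlt]
          simp [Instr.exec, h13, hB.r5]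
        · simpa [Instr.exec, h13, e, him] using hf c hc (by omega)
  · rintro σ' ⟨hB, h10, h13, -⟩
    rw [h13, h10]; omega
  · rintro σ' ⟨hB, h10, h13, h15, hp, hf⟩
    exact ⟨hB, h10, by omega, h15, fun c hc => hf c hc (by omega)⟩

/-- Stores the entry with the index in register `8` of each of the vectors of level zero. -/
def initStep : Program :=
  .seq (line (.iadd 16 10 8) [.rstore 16 0, .iadd 16 11 8, .rstore 16 1, .iadd 16 12 8])
    (.seq (.ifLt 8 15 (line (.rstore 16 1) []) (line (.rstore 16 0) []))
    (line (.iadd 8 8 5) []))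

/-- Stores the vectors of level zero. -/
def initVectors : Program :=
  .seq (line (.iadd 11 10 0) [.iadd 12 11 0, .iconst 8 0, .rconst 0 0, .rconst 1 1])
  (.seq (.whileLt 8 0 initStep)
  (line (.iconst 8 0) [.iconst 9 0]))

/-- The registers and flags during the initialization of the vectors of level zero. -/
structure InitBase (d s k F x : ℕ) (σ₀ : State) (j : ℕ) (σ : State) : Prop where
  base : Base d s k F σ₀ σ
  r8 : σ.ireg 8 = j
  r10 : σ.ireg 10 = F
  r11 : σ.ireg 11 = F + d
  r12 : σ.ireg 12 = F + d + d
  r13 : σ.ireg 13 = F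
  r15 : σ.ireg 15 = resid d k x k
  f0 : σ.rreg 0 = 0
  f1 : σ.rreg 1 = 1
  flags : ∀ c < k, σ.imem (F + c) = flag d k x c

/-- The first `j` entries of the vectors of level zero are stored. -/
def InitVec (d F r j : ℕ) (m : ℕ → ℝ) : Prop :=
  ∀ i < j, m (F + i) = 0 ∧ m (F + d + i) = 1 ∧ m (F + d + d + i) = if i < r then 1 else 0

theorem InitVec.step {d F r j : ℕ} {m : ℕ → ℝ} (h : InitVec d F r j m) (hj : j < d) :
    InitVec d F r (j + 1) (Function.update (Function.update (Function.update m (F + j) 0)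
      (F + d + j) 1) (F + d + d + j) (if j < r then 1 else 0)) := by
  intro i hi
  have e1 : F + i ≠ F + d + j := by omega
  have e2 : F + i ≠ F + d + d + j := by omega
  have e3 : F + d + i ≠ F + d + d + j := by omega
  rw [Function.update_of_ne e2, Function.update_of_ne e1, Function.update_of_ne e3]
  by_cases e : i = j
  · subst e; simp
  · have e4 : F + i ≠ F + j := by omega
    have e5 : F + d + i ≠ F + d + j := by omega
    have e6 : F + d + d + i ≠ F + d + d + j := by omega
    have e7 : F + d + i ≠ F + j := by omega
    have e8 : F + d + d + i ≠ F + d + j := by omega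
    have e9 : F + d + d + i ≠ F + j := by omega
    rw [Function.update_of_ne e4, Function.update_of_ne e5, Function.update_of_ne e6,
      Function.update_of_ne e7, Function.update_of_ne e8, Function.update_of_ne e9]
    exact h i (by omega)

theorem InitBase.of_agree {d s k F x j : ℕ} {σ₀ σ σ' : State} (h : InitBase d s k F x σ₀ j σ)
    (hreg : ∀ t ≤ 15, σ'.ireg t = σ.ireg t) (hrr : σ'.rreg = σ.rreg) (him : σ'.imem = σ.imem)
    (hrm : ∀ a < F, σ'.rmem a = σ.rmem a) : InitBase d s k F x σ₀ j σ' where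
  base := h.base.of_agree (fun t ht => hreg t (by omega)) (fun a _ => by rw [him]) hrm
  r8 := (hreg 8 (by norm_num)).trans h.r8
  r10 := (hreg 10 (by norm_num)).trans h.r10
  r11 := (hreg 11 (by norm_num)).trans h.r11
  r12 := (hreg 12 (by norm_num)).trans h.r12
  r13 := (hreg 13 (by norm_num)).trans h.r13
  r15 := (hreg 15 (by norm_num)).trans h.r15
  f0 := by rw [hrr, h.f0]
  f1 := by rw [hrr, h.f1]
  flags := by rw [him]; exact h.flags

theorem exec_initStep {d s k F x j : ℕ} (hj : j < d) (σ₀ σ : State)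
    (h : InitBase d s k F x σ₀ j σ) (hv : InitVec d F (resid d k x k) j σ.rmem) :
    Exec initStep σ 8 fun σ' => InitBase d s k F x σ₀ (j + 1) σ' ∧
      InitVec d F (resid d k x k) (j + 1) σ'.rmem := by
  refine Exec.mono (T := 5 + ((1 + 1) + 1)) ?_ le_rfl fun _ h => h
  refine Exec.seq (Exec.line (Q := fun σ' => InitBase d s k F x σ₀ j σ' ∧
    σ'.ireg 16 = F + d + d + j ∧
    σ'.rmem = Function.update (Function.update σ.rmem (F + j) 0) (F + d + j) 1) ?_) ?_
  · refine ⟨h.of_agree (fun t ht => ?_) ?_ ?_ (fun a ha => ?_), ?_, ?_⟩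
    · have e1 : t ≠ 16 := by omega
      simp [Instr.exec, e1]
    · simp [Instr.exec]
    · simp [Instr.exec]
    · have e1 : a ≠ F + j := by omega
      have e2 : a ≠ F + d + j := by omega
      simp [Instr.exec, h.r10, h.r11, h.r8, e1, e2]
    · simp [Instr.exec, h.r12, h.r8]
    · simp [Instr.exec, h.r10, h.r11, h.r8, h.f0, h.f1]
  rintro σ₁ ⟨h₁, h16, hrm⟩
  refine Exec.seq (Q := fun σ' => InitBase d s k F x σ₀ j σ' ∧
    σ'.rmem = Function.update σ₁.rmem (F + d + d + j) (if j < resid d k x k then 1 else 0))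
    (Exec.ifLt (fun hlt => Exec.line ?_) (fun hlt => Exec.line ?_)) ?_
  · rw [h₁.r8, h₁.r15] at hlt
    refine ⟨h₁.of_agree (fun _ _ => rfl) rfl rfl (fun a ha => ?_), ?_⟩
    · have e1 : a ≠ F + d + d + j := by omega
      simp [Instr.exec, h16, e1]
    · simp only [List.foldl, Instr.exec]
      rw [h16, h₁.f1, if_pos hlt]
  · rw [h₁.r8, h₁.r15] at hlt
    refine ⟨h₁.of_agree (fun _ _ => rfl) rfl rfl (fun a ha => ?_), ?_⟩
    · have e1 : a ≠ F + d + d + j := by omega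
      simp [Instr.exec, h16, e1]
    · simp only [List.foldl, Instr.exec]
      rw [h16, h₁.f0, if_neg hlt]
  rintro σ₂ ⟨h₂, hrm₂⟩
  have hv₂ := hv.step hj
  rw [← hrm, ← hrm₂] at hv₂
  refine Exec.line ⟨⟨h₂.base.of_agree (fun t ht => ?_) (fun _ _ => rfl) (fun _ _ => rfl),
    ?_, h₂.r10, h₂.r11, h₂.r12, h₂.r13, h₂.r15, h₂.f0, h₂.f1, h₂.flags⟩, hv₂⟩
  · have e1 : t ≠ 8 := by omega
    simp [Instr.exec, e1]
  · simp [Instr.exec, h₂.r8, h₂.base.r5]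

theorem exec_initVectors {k d s : ℕ} (q : Fin k → MapSeed d s) (x : ℕ) (σ₀ σ : State)
    (hB : Base d s k (k * (2 * (d * s))) σ₀ σ) (h10 : σ.ireg 10 = k * (2 * (d * s)))
    (h13 : σ.ireg 13 = k * (2 * (d * s))) (h15 : σ.ireg 15 = resid d k x k)
    (hm : ∀ c < k, σ.imem (k * (2 * (d * s)) + c) = flag d k x c) :
    Exec initVectors σ (9 * d + 8) (LevelInv q x σ₀ 0) := by
  let I : ℕ → State → Prop := fun j σ' => InitBase d s k (k * (2 * (d * s))) x σ₀ j σ' ∧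
    InitVec d (k * (2 * (d * s))) (resid d k x k) j σ'.rmem
  refine Exec.mono (T := 5 + ((d * (8 + 1) + 1) + 2)) (Q := LevelInv q x σ₀ 0)
    (Exec.seq (Exec.line (Q := I 0) ?_) fun σ₁ h₁ => Exec.seq (Q := I d)
      (Exec.whileLt I h₁ ?_ ?_) fun σ₂ h₂ => Exec.line ?_) (by omega) fun _ h => h
  · refine ⟨⟨hB.of_agree (fun t ht => ?_) (fun _ _ => rfl) (fun _ _ => rfl), ?_, ?_, ?_, ?_, ?_, ?_,
      ?_, ?_, hm⟩, fun i hi => absurd hi (Nat.not_lt_zero i)⟩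
    · have e1 : t ≠ 8 := by omega
      have e2 : t ≠ 11 := by omega
      have e3 : t ≠ 12 := by omega
      simp [Instr.exec, e1, e2, e3]
    all_goals simp [Instr.exec, hB.r0, h10, h13, h15]
  · rintro j hj σ' ⟨h, hv⟩
    exact ⟨by rw [h.r8, h.base.r0]; exact hj, exec_initStep hj σ₀ σ' h hv⟩
  · rintro σ' ⟨h, -⟩
    rw [h.r8, h.base.r0]; exact lt_irrefl _
  · obtain ⟨h, hv⟩ := h₂
    refine ⟨h.base.of_agree (fun t ht => ?_) (fun _ _ => rfl) (fun _ _ => rfl), Nat.zero_le k,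
      ?_, ?_, ?_, ?_, ?_, ?_, h.flags, fun i => ?_, fun i => ?_, fun i => ?_⟩
    · have e1 : t ≠ 8 := by omega
      have e2 : t ≠ 9 := by omega
      simp [Instr.exec, e1, e2]
    · simp [Instr.exec]
    · simp [Instr.exec]
    · simp [Instr.exec, h.r10]
    · simp [Instr.exec, h.r10, h.r12]; omega
    · simp [Instr.exec, h.r11, h.r12]
    · simp [Instr.exec, h.r13]
    · simpa [Instr.exec, h.r10] using (hv i i.2).1
    · simpa [Instr.exec, h.r11, preprocess] using (hv i i.2).2.1
    · simpa [Instr.exec, h.r12, project, unary] using (hv i i.2).2.2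

/-! ### The whole program -/

/-- The program that computes `ψ`. -/
def embedProgram : Program :=
  .seq computeSizes (.seq computePowers (.seq computeFlags (.seq initVectors
    (.seq (.whileLt 8 2 levelBody) (line (.iadd 0 12 4) [])))))

theorem HoldsInput.holdsMap {k d s : ℕ} {q : Fin k → MapSeed d s} {x : ℕ} {σ : State}
    (h : HoldsInput q x σ) (l : Fin k) : HoldsMap (q l) (l * (2 * (d * s))) σ := by
  intro b c j
  have := h.2.2.2.2 l b c j
  have e : (((l : ℕ) * 2 + (b : ℕ)) * d + (c : ℕ)) * s + (j : ℕ)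
      = l * (2 * (d * s)) + b * (d * s) + c * s + j := by ring
  rw [← e]
  exact this

theorem exec_embedProgram {k d s : ℕ} (q : Fin k → MapSeed d s) (x : ℕ) (σ : State)
    (h : HoldsInput q x σ) :
    Exec embedProgram σ (13 * d + k * (40 * (d * s) + 32 * d + 55) + 24) fun σ' =>
      HoldsOutput (project (fun i => (q i).toMap) k le_rfl x) σ' := by
  refine Exec.mono (T := (4 * d + 3 * k + 8) + ((5 * k + 4) + ((6 * k + 2) + ((9 * d + 8) +
    ((k * (2 * (d * (20 * s + 16)) + 40 + 1) + 1) + 1)))))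
    (Exec.seq (exec_computeSizes σ h.1 h.2.1 h.2.2.1 h.2.2.2.1) ?_) (by ring_nf; omega)
    fun _ h => h
  rintro σ₁ ⟨hB₁, h3, h10⟩
  refine Exec.seq (exec_computePowers σ σ₁ hB₁ h3 h10) ?_
  rintro σ₂ ⟨hB₂, h3, h10, h13, hp⟩
  refine Exec.seq (exec_computeFlags σ σ₂ hB₂ h3 h10 h13 hp) ?_
  rintro σ₃ ⟨hB₃, h10, h13, h15, hf⟩
  refine Exec.seq (exec_initVectors q x σ σ₃ hB₃ h10 h13 h15 hf) fun σ₄ h₄ => ?_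
  refine Exec.seq (Exec.whileLt (N := k) (LevelInv q x σ) h₄ (fun c hc σ' h' =>
    ⟨by rw [h'.r8, h'.base.r2]; exact hc, exec_levelBody q x σ h.holdsMap c hc σ' h'⟩)
    fun σ' h' => by rw [h'.r8, h'.base.r2]; exact lt_irrefl _) fun σ₅ h₅ => Exec.line fun i => ?_
  have := h₅.proj i
  rw [Nat.sub_self] at this
  simpa [Instr.exec, h₅.base.r4, resid] using this

theorem exec_embedProgram_time {n d s u : ℕ} {K ε : ℝ} (hn : 2 ≤ n) (hu : 2 ≤ u) (hε : 0 < ε)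
    (hd0 : 0 < d) (hs0 : 0 < s) (hd : (d : ℝ) ≤ K * Real.log n / ε ^ 2)
    (hs : (s : ℝ) ≤ K * (d * ε)) (q : Fin (levels d u) → MapSeed d s) (x : ℕ) (σ : State)
    (h : HoldsInput q x σ) :
    ∃ (t : ℕ) (σ' : State), Runs embedProgram σ t σ' ∧ HoldsOutput (psi u q x) σ' ∧
      (t : ℝ) ≤ 820 * K ^ 3 * (Real.log n ^ 2 * Real.log u / ε ^ 3) := by
  obtain ⟨t, σ', hr, ht, ho⟩ := exec_embedProgram q x σ h
  refine ⟨t, σ', hr, ho, ?_⟩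
  have hd0' : (0 : ℝ) < d := by exact_mod_cast hd0
  have hs0' : (0 : ℝ) < s := by exact_mod_cast hs0
  have hK : 0 < K := by
    have : 0 < K * (d * ε) := lt_of_lt_of_le hs0' hs
    exact pos_of_mul_pos_left this (by positivity)
  have hlogn : 0 < Real.log n := Real.log_pos (by exact_mod_cast hn)
  have hlogu : 1 ≤ 2 * Real.log u := by
    have : Real.log 2 ≤ Real.log u := Real.log_le_log (by norm_num) (by exact_mod_cast hu)
    linarith [Real.log_two_gt_d9]
  -- Since `d, s ≥ 1`, every term is absorbed into `d s` or `k d s`, with `13 + 24 + 40 + 32 + 55 =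
  -- 164`.
  have h1 : t ≤ 164 * ((levels d u + 1) * (d * s)) := by
    have hds : d ≤ d * s := Nat.le_mul_of_pos_right d hs0
    have hk : levels d u * d ≤ levels d u * (d * s) := Nat.mul_le_mul_left _ hds
    have hk1 : levels d u * 1 ≤ levels d u * (d * s) := Nat.mul_le_mul_left _ (by omega)
    refine ht.trans ?_
    have e1 : levels d u * (40 * (d * s) + 32 * d + 55)
        = 40 * (levels d u * (d * s)) + 32 * (levels d u * d) + 55 * (levels d u * 1) := by ring
    have e2 : (levels d u + 1) * (d * s) = levels d u * (d * s) + d * s := by ring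
    rw [e1, e2]
    omega
  -- Three from the number of levels and two from `1 ≤ 2 log u`; the final constant is `164 * 5 =
  -- 820`.
  have h2 : (levels d u : ℝ) + 1 ≤ 5 * Real.log u := by linarith [levels_le_log hd0 hu]
  have h3 : (d : ℝ) * s ≤ K ^ 3 * (Real.log n ^ 2 / ε ^ 3) := by
    calc (d : ℝ) * s ≤ d * (K * (d * ε)) := by gcongr
      _ = K * ε * d ^ 2 := by ring
      _ ≤ K * ε * (K * Real.log n / ε ^ 2) ^ 2 := by gcongr
      _ = K ^ 3 * (Real.log n ^ 2 / ε ^ 3) := by field_simp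
  calc (t : ℝ) ≤ 164 * (((levels d u : ℝ) + 1) * (d * s)) := by exact_mod_cast h1
    _ ≤ 164 * ((5 * Real.log u) * (K ^ 3 * (Real.log n ^ 2 / ε ^ 3))) := by gcongr
    _ = 820 * K ^ 3 * (Real.log n ^ 2 * Real.log u / ε ^ 3) := by ring

end L1Embedding

end

theorem mainTheorem6 :
    ∃ (prog : L1Embedding.Program) (C₁ : ℝ), ∀ a b κ : ℝ, 0 < a → 0 < b → 0 < κ →
      ∃ C₀ : ℝ, 0 < C₀ ∧ ∀ K : ℝ, ∃ C₂ : ℝ,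
        ∀ (n d s u : ℕ) (ε : ℝ), 2 ≤ n → 2 ≤ u → 0 < ε → ε ≤ 1 →
          C₀ * Real.log n / ε ^ 2 ≤ d → (d : ℝ) ≤ K * Real.log n / ε ^ 2 →
          κ * (d * ε) ≤ s → (s : ℝ) ≤ K * (d * ε) → s ≤ d →
          -- `ψ` is the linear map of recursive pairwise compression, in the unary encoding
          (∀ (q : Fin (L1Embedding.levels d u) → L1Embedding.MapSeed d s) (x : ℕ), x ≤ u →
            L1Embedding.psi u q x =
              L1Embedding.compressAll (fun i => (q i).toMap) (L1Embedding.levels d u) le_rfl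
                (L1Embedding.unary (d * 2 ^ L1Embedding.levels d u) x)) ∧
          -- distortion, for each pair and (for polynomial `u`) for all pairs simultaneously
          (ε * L1Embedding.levels d u ≤ 1 →
            (∀ x y : ℕ, x ≤ u → y ≤ u →
              1 - (n : ℝ) ^ (-a) ≤
                (L1Embedding.mapsLaw (L1Embedding.levels d u) d s).real
                  {q | L1Embedding.ApproxEq (C₁ * (ε * Real.log u)) |(x : ℝ) - y|
                    (‖L1Embedding.psi u q x - L1Embedding.psi u q y‖ ^ 2)}) ∧
            ((u : ℝ) ≤ (n : ℝ) ^ b →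
              1 - (n : ℝ) ^ (-a) ≤
                (L1Embedding.mapsLaw (L1Embedding.levels d u) d s).real
                  {q | ∀ x y : ℕ, x ≤ u → y ≤ u →
                    L1Embedding.ApproxEq (C₁ * (ε * Real.log u)) |(x : ℝ) - y|
                      (‖L1Embedding.psi u q x - L1Embedding.psi u q y‖ ^ 2)})) ∧
          -- running time, including the preprocessing
          (∀ (q : Fin (L1Embedding.levels d u) → L1Embedding.MapSeed d s) (x : ℕ), x ≤ u →
            ∀ σ : L1Embedding.State, L1Embedding.HoldsInput q x σ →
              ∃ (t : ℕ) (σ' : L1Embedding.State),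
                L1Embedding.Runs prog σ t σ' ∧
                L1Embedding.HoldsOutput (L1Embedding.psi u q x) σ' ∧
                (t : ℝ) ≤ C₂ * (Real.log n ^ 2 * Real.log u / ε ^ 3)) := by
  -- One dimension constant serves both distortion claims; its parameter `a + 2 b + 2` is dictated
  -- by the union bound over all pairs.
  refine ⟨L1Embedding.embedProgram, 6, fun a b κ ha hb hκ =>
    ⟨L1Embedding.dimConst (a + 2 * b + 2) κ, L1Embedding.dimConst_pos (by positivity) hκ,
      fun K => ⟨820 * K ^ 3, fun n d s u ε hn hu hε _ hd hdK hs hsK hsd => ?_⟩⟩⟩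
  have hC := L1Embedding.dimConst_pos (a := a + 2 * b + 2) (by positivity) hκ
  have hlog : 0 < Real.log n := Real.log_pos (by exact_mod_cast hn)
  have hd' : (0 : ℝ) < d := lt_of_lt_of_le (by positivity) hd
  have hs' : (0 : ℝ) < s := lt_of_lt_of_le (by positivity) hs
  have hd0 : 0 < d := by exact_mod_cast hd'
  have hs0 : 0 < s := by exact_mod_cast hs'
  refine ⟨fun q x hx => ?_, fun hεk => ⟨fun x y hx hy => ?_, fun hub => ?_⟩,
    fun q x _ σ hσ => ?_⟩
  · exact L1Embedding.project_eq _ _ _ _ (hx.trans (L1Embedding.le_mul_two_pow_levels hd0))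
  · exact L1Embedding.le_mapsLaw_approxEq_psi ha hb hκ hn hu hε hd hs hsd hεk hx hy
  · exact L1Embedding.le_mapsLaw_forall_approxEq_psi ha hb hκ hn hu hε hd hs hsd hεk hub
  · exact L1Embedding.exec_embedProgram_time hn hu hε hd0 hs0 hdK hsK q x σ hσ
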